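/- **Setting.** Operators act on finite dimensional complex Hilbert spaces; an observable is a Hermitian operator, and repeated upper/lower indices are summed. For positive operators $\rho,\sigma$ let $\operatorname{supp}\rho=(\ker\rho)^\perp$, let $\iota_\rho:\operatorname{supp}\rho\hookrightarrow\mathcal H$ be the inclusion, and let $\sigma|_\rho:=\iota_\rho^*\sigma\iota_\rho$. Write $\rho\ll\sigma$ (or $\sigma\gg\rho$) if $\sigma|_\rho>0$, and $\rho\perp\sigma$ if $\sigma|_\rho=0$. The quantum Lebesgue decomposition of $\sigma$ with respect to $\rho$ is $\sigma=\sigma^a+\sigma^\perp$ with $\sigma^a,\sigma^\perp\ge 0$, $\sigma^a\ll\rho$, $\sigma^\perp\perp\rho$. If $\rho\ll\sigma$, (a version of) the quantum log-likelihood ratio $\mathcal L(\sigma|\rho)$ is a Hermitian operator $\mathcal L$ with $\sigma^a=e^{\mathcal L/2}\rho\,e^{\mathcal L/2}$; by convention $\mathcal L(\rho|\rho)=0$. For $h\in\mathbb R^m$ and a Hermitian positive semidefinite $m\times m$ matrix $J$, observables $X^{(n)}=(X^{(n)}_1,\dots,X^{(n)}_m)$ and states $\rho^{(n)}$ on $\mathcal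 H^{(n)}$ satisfy $X^{(n)}\xrightarrow{\rho^{(n)}}N(h,J)$ if for every finite sequence $\xi_1,\dots,\xi_s\in\mathbb C^m$ $$\lim_{n\to\infty}\operatorname{Tr}\rho^{(n)}\prod_{t=1}^{s}e^{\sqrt{-1}\,\xi_t^iX_i^{(n)}}=\exp\Big(\sum_{t=1}^s\big(\sqrt{-1}\,\xi_t^ih_i-\tfrac12\xi_t^i\xi_t^jJ_{ji}\big)-\sum_{t<u}\xi_t^i\xi_u^jJ_{ji}\Big)$$ (ordered product), the right-hand side being the quasi-characteristic function of the quantum Gaussian state $N(h,J)$. If $X^{(n)}\xrightarrow{\rho^{(n)}}N(0,J)$, a sequence $R^{(n)}$ of observables is $o(X^{(n)},\rho^{(n)})$ if for all $\xi_t\in\mathbb C^m$, $\eta_t\in\mathbb C$ the limit of $\operatorname{Tr}\rho^{(n)}\prod_te^{\sqrt{-1}(\xi_t^iX_i^{(n)}+\eta_tR^{(n)})}$ is that same expression with $h=0$. Let $\Theta\subset\mathbb R^d$ be open, $\theta_0\in\Theta$. A sequence of models $\{\rho^{(n)}_\theta\}_{\theta\in\Theta}$ of density operators, together with observables $X^{(n)}=(X_1^{(n)},\dots,X_r^{(n)})$,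 is *jointly q-LAN* at $\theta_0$ if (i) $\rho^{(n)}_\theta\gg\rho^{(n)}_{\theta_0}$ for all $\theta\in\Theta$, $n\ge1$; (ii) there are observables $\Delta^{(n)}=(\Delta_1^{(n)},\dots,\Delta_d^{(n)})$ with $$\begin{pmatrix}X^{(n)}\\ \Delta^{(n)}\end{pmatrix}\xrightarrow{\rho^{(n)}_{\theta_0}}N\left(\begin{pmatrix}0\\0\end{pmatrix},\begin{pmatrix}\Sigma&\tau\\ \tau^*&J\end{pmatrix}\right),$$ where $\Sigma,J$ are Hermitian positive semidefinite, $\tau$ is a complex $r\times d$ matrix and $\operatorname{Re}J>0$; (iii) for every $h\in\mathbb R^d$, a version of $\mathcal L_h^{(n)}=\mathcal L(\rho^{(n)}_{\theta_0+h/\sqrt n}|\rho^{(n)}_{\theta_0})$ satisfies $\mathcal L^{(n)}_h=h^i\Delta_i^{(n)}-\tfrac12(J_{ij}h^ih^j)I^{(n)}+o\big((X^{(n)},\Delta^{(n)}),\rho^{(n)}_{\theta_0}\big)$. **Statement.** Let $\{\rho_\theta\mid\theta\in\Theta\}$, with $\Theta\subset\mathbb R^d$ open, be a family of density operators on a finite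 dimensional Hilbert space $\mathcal H$, and let $\theta_0\in\Theta$ be such that $\rho_\theta\gg\rho_{\theta_0}$ for all $\theta\in\Theta$. Let $B_1,\dots,B_r$ be observables on $\mathcal H$ with $\operatorname{Tr}\rho_{\theta_0}B_i=0$. Suppose that (a version of) $\mathcal L_h:=\mathcal L(\rho_{\theta_0+h}|\rho_{\theta_0})$, with $\mathcal L_0=0$, is differentiable at $h=0$ and that $\operatorname{Tr}\rho_{\theta_0}e^{\mathcal L_h}=1-o(\|h\|^2)$ as $h\to0$. Then symmetric logarithmic derivatives at $\theta_0$ exist, i.e. there are Hermitian $L_1,\dots,L_d$ with $\partial_i\rho_\theta|_{\theta=\theta_0}=\frac12(\rho_{\theta_0}L_i+L_i\rho_{\theta_0})$. For any such $L_1,\dots,L_d$ put $$\Sigma_{ij}=\operatorname{Tr}\rho_{\theta_0}B_jB_i,\qquad \tau_{ij}=\operatorname{Tr}\rho_{\theta_0}L_jB_i,\qquad J_{ij}=\operatorname{Tr}\rho_{\theta_0}L_jL_i,$$ $$X_i^{(n)}=\frac1{\sqrt n}\sum_{k=1}^nI^{\otimes(k-1)}\otimes B_i\otimes I^{\otimes(n-k)},\qquad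 \Delta_i^{(n)}=\frac1{\sqrt n}\sum_{k=1}^nI^{\otimes(k-1)}\otimes L_i\otimes I^{\otimes(n-k)}.$$ (a) If $\operatorname{Re}J>0$ (equivalently, the derivatives $\partial_i\rho_\theta|_{\theta=\theta_0}$ are linearly independent over $\mathbb R$), then $(\{\rho_\theta^{\otimes n}\},X^{(n)})$ is jointly q-LAN at $\theta_0$, with these $\Delta^{(n)},\Sigma,\tau,J$. (b) For every $h\in\mathbb R^d$ (whether or not $\operatorname{Re}J>0$), $X^{(n)}\xrightarrow{\rho_{\theta_0+h/\sqrt n}^{\otimes n}}N((\operatorname{Re}\tau)h,\Sigma)$. -/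

import Mathlib

open Filter Topology
open scoped Matrix ComplexOrder

noncomputable section

namespace QLAN

/-- The parameter space `ℝ^d` with its Euclidean norm. -/
abbrev Param (d : ℕ) : Type := EuclideanSpace ℝ (Fin d)

section Operators

variable {ι : Type*} [Fintype ι] [DecidableEq ι]

/-- Operators on the finite dimensional Hilbert space `ℂ^ι` are complex `ι × ι` matrices.
A density operator is a positive semidefinite operator of trace one. -/
structure IsDensity (ρ : Matrix ι ι ℂ) : Prop where
  posSemidef : ρ.PosSemidef
  trace_eq_one : ρ.trace = 1

/-- `supp ρ = (ker ρ)ᗮ`. -/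
def supp (ρ : Matrix ι ι ℂ) : Submodule ℂ (EuclideanSpace ℂ ι) :=
  (LinearMap.ker (Matrix.toEuclideanLin ρ))ᗮ

/-- The excision `ι_ρ^* σ ι_ρ` of `σ` relative to `ρ`, an operator on `supp ρ`, where
`ι_ρ : supp ρ → ℂ^ι` is the inclusion. -/
def excision (σ ρ : Matrix ι ι ℂ) : supp ρ →ₗ[ℂ] supp ρ :=
  LinearMap.adjoint (𝕜 := ℂ) (E := supp ρ) (F := EuclideanSpace ℂ ι) (supp ρ).subtype ∘ₗ
    Matrix.toEuclideanLin σ ∘ₗ (supp ρ).subtype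

/-- `ρ ⟂ σ`: the excision of `σ` relative to `ρ` vanishes. -/
def Singular (ρ σ : Matrix ι ι ℂ) : Prop := excision σ ρ = 0

/-- `ρ ≪ σ` (that is, `σ ≫ ρ`): the excision of `σ` relative to `ρ` is strictly positive. -/
def AbsCont (ρ σ : Matrix ι ι ℂ) : Prop :=
  LinearMap.IsSymmetric (𝕜 := ℂ) (E := supp ρ) (excision σ ρ) ∧
    ∀ x : supp ρ, x ≠ 0 → 0 < (inner ℂ x (excision σ ρ x)).re

/-- `σ = σa + σs` is the quantum Lebesgue decomposition of `σ` with respect to `ρ`: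
`σa, σs ≥ 0`, `σa ≪ ρ` and `σs ⟂ ρ`. -/
structure IsLebesgueDecomp (σ ρ σa σs : Matrix ι ι ℂ) : Prop where
  eq_add : σ = σa + σs
  posSemidef_ac : σa.PosSemidef
  posSemidef_sing : σs.PosSemidef
  absCont : AbsCont σa ρ
  singular : Singular σs ρ

/-- `L` is (a version of) the quantum log-likelihood ratio `𝓛(σ | ρ)`: a Hermitian operator with
`σᵃ = exp (L/2) ρ exp (L/2)`, where `σᵃ` is the absolutely continuous part of `σ` with respect
to `ρ`. It is in general not unique. -/
def IsLogLikelihoodRatio (L σ ρ : Matrix ι ι ℂ) : Prop :=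
  L.IsHermitian ∧ ∃ σa σs : Matrix ι ι ℂ, IsLebesgueDecomp σ ρ σa σs ∧
    σa = NormedSpace.exp ((1 / 2 : ℂ) • L) * ρ * NormedSpace.exp ((1 / 2 : ℂ) • L)

/-- `S` is (a version of) the symmetric logarithmic derivative of the model `θ ↦ ρ θ` at `θ₀` in
the `i`-th direction: `S` is Hermitian and `∂ᵢ ρ (θ₀) = (ρ S + S ρ) / 2`, `ρ = ρ θ₀`. -/
def IsSLD {d : ℕ} (ρ : Param d → Matrix ι ι ℂ) (θ₀ : Param d) (i : Fin d)
    (S : Matrix ι ι ℂ) : Prop :=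
  S.IsHermitian ∧
    HasDerivAt (fun t : ℝ => ρ (θ₀ + t • EuclideanSpace.single i (1 : ℝ)))
      ((1 / 2 : ℂ) • (ρ θ₀ * S + S * ρ θ₀)) 0

/-- The matrix `(Tr ρ A_j B_i)_{ij}`. -/
def covMatrix {κ κ' : Type*} (ρ : Matrix ι ι ℂ) (B : κ → Matrix ι ι ℂ) (A : κ' → Matrix ι ι ℂ) :
    Matrix κ κ' ℂ :=
  Matrix.of fun i j => (ρ * A j * B i).trace

/-- The tensor product `A 0 ⊗ ⋯ ⊗ A (n-1)` on `(ℂ^ι)^{⊗ n} = ℂ^(ι^n)`. -/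
def tensor {n : ℕ} (A : Fin n → Matrix ι ι ℂ) : Matrix (Fin n → ι) (Fin n → ι) ℂ :=
  Matrix.of fun x y => ∏ k, A k (x k) (y k)

/-- `ρ^{⊗ n}`. -/
def tensorPow (n : ℕ) (ρ : Matrix ι ι ℂ) : Matrix (Fin n → ι) (Fin n → ι) ℂ :=
  tensor fun _ => ρ

/-- `n^{-1/2} ∑_k I^{⊗(k-1)} ⊗ B ⊗ I^{⊗(n-k)}`. -/
def normalizedSum (n : ℕ) (B : Matrix ι ι ℂ) : Matrix (Fin n → ι) (Fin n → ι) ℂ :=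
  ((Real.sqrt n : ℝ) : ℂ)⁻¹ • ∑ k : Fin n, tensor (Function.update (fun _ => 1) k B)

end Operators

/-- A quantum statistical model: density operators `ρ θ` indexed by an open set `Θ ⊆ ℝ^d`. (The
values of `ρ` outside `Θ` are irrelevant.) -/
structure IsModel {ι : Type*} [Fintype ι] [DecidableEq ι] {d : ℕ} (Θ : Set (Param d))
    (ρ : Param d → Matrix ι ι ℂ) : Prop where
  isOpen : IsOpen Θ
  isDensity : ∀ θ ∈ Θ, IsDensity (ρ θ)

/-- The quasi-characteristic function `φ (∏_{t=1}^s exp (√-1 ξ_t^i X_i))` of the quantum Gaussian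
state `(X, φ) ∼ N(h, J)`, at `ξ_1, …, ξ_s ∈ ℂ^κ`:
`exp (∑_t (√-1 ξ_t^i h_i - ½ ξ_t^i ξ_t^j J_ji) - ∑_{t<u} ξ_t^i ξ_u^j J_ji)`. -/
def gaussianQuasiChar {κ : Type*} [Fintype κ] (h : κ → ℝ) (J : Matrix κ κ ℂ)
    {s : ℕ} (ξ : Fin s → κ → ℂ) : ℂ :=
  Complex.exp
    (∑ t, (Complex.I * ∑ i, ξ t i * (h i : ℂ) - 1 / 2 * ∑ i, ∑ j, ξ t i * ξ t j * J j i)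
      - ∑ t, ∑ u ∈ Finset.Ioi t, ∑ i, ∑ j, ξ t i * ξ u j * J j i)

section Sequences

variable {N : ℕ → Type*} [∀ n, Fintype (N n)] [∀ n, DecidableEq (N n)]

/-- The sequence `(X⁽ⁿ⁾, ρ⁽ⁿ⁾)` converges in law to the quantum Gaussian state `N(h, J)`; the matrix
`J` of a quantum Gaussian state is Hermitian positive semidefinite. The product is the ordered
one. -/
def ConvergesInLaw {κ : Type*} [Fintype κ] (X : ∀ n, κ → Matrix (N n) (N n) ℂ)
    (ρ : ∀ n, Matrix (N n) (N n) ℂ) (h : κ → ℝ) (J : Matrix κ κ ℂ) : Prop :=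
  J.PosSemidef ∧ ∀ (s : ℕ) (ξ : Fin s → κ → ℂ),
    Tendsto
      (fun n => (ρ n *
        (List.ofFn fun t => NormedSpace.exp (Complex.I • ∑ i, ξ t i • X n i)).prod).trace)
      atTop (𝓝 (gaussianQuasiChar h J ξ))

/-- `R⁽ⁿ⁾ = o(X⁽ⁿ⁾, ρ⁽ⁿ⁾)`: the sequence `R` of observables is infinitesimal relative to the
convergence of `(X⁽ⁿ⁾, ρ⁽ⁿ⁾)` to `N(0, J)`. -/
def IsInfinitesimal {κ : Type*} [Fintype κ] (X : ∀ n, κ → Matrix (N n) (N n) ℂ)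
    (ρ : ∀ n, Matrix (N n) (N n) ℂ) (J : Matrix κ κ ℂ) (R : ∀ n, Matrix (N n) (N n) ℂ) : Prop :=
  ConvergesInLaw X ρ 0 J ∧ (∀ᶠ n in atTop, (R n).IsHermitian) ∧
  ∀ (s : ℕ) (ξ : Fin s → κ → ℂ) (η : Fin s → ℂ),
    Tendsto
      (fun n => (ρ n *
        (List.ofFn fun t =>
          NormedSpace.exp (Complex.I • (∑ i, ξ t i • X n i + η t • R n))).prod).trace)
      atTop (𝓝 (gaussianQuasiChar 0 J ξ))

/-- The pair `({ρ⁽ⁿ⁾_θ}, X⁽ⁿ⁾)` is jointly quantum locally asymptotically normal at `θ₀`, with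
`Δ⁽ⁿ⁾` and the matrices `C` (the covariance of `X`), `τ` and `J` as the objects whose existence is
required. The local parameter `θ₀ + h/√n` lies in `Θ` for all large `n`, and only for such `n` the
log-likelihood ratio `𝓛⁽ⁿ⁾_h` is meaningful; "`𝓛⁽ⁿ⁾_h` is expanded as" means that some version of
it is. -/
structure IsJointlyQLAN {d r : ℕ} (Θ : Set (Param d)) (ρ : ∀ n, Param d → Matrix (N n) (N n) ℂ)
    (θ₀ : Param d) (X : ∀ n, Fin r → Matrix (N n) (N n) ℂ)
    (Δ : ∀ n, Fin d → Matrix (N n) (N n) ℂ)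
    (C : Matrix (Fin r) (Fin r) ℂ) (τ : Matrix (Fin r) (Fin d) ℂ)
    (J : Matrix (Fin d) (Fin d) ℂ) : Prop where
  isModel : ∀ n, 0 < n → IsModel Θ (ρ n)
  mem : θ₀ ∈ Θ
  isHermitian_X : ∀ n, 0 < n → ∀ i, (X n i).IsHermitian
  absCont : ∀ n, 0 < n → ∀ θ ∈ Θ, AbsCont (ρ n θ₀) (ρ n θ)
  isHermitian_Δ : ∀ n, 0 < n → ∀ i, (Δ n i).IsHermitian
  posSemidef_C : C.PosSemidef
  posSemidef_J : J.PosSemidef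
  posDef_re_J : (J.map Complex.re).PosDef
  convergesInLaw : ConvergesInLaw (fun n => Sum.elim (X n) (Δ n)) (fun n => ρ n θ₀) 0
    (Matrix.fromBlocks C τ τᴴ J)
  expansion : ∀ h : Param d, ∃ 𝓛 : ∀ n, Matrix (N n) (N n) ℂ,
    (∀ n : ℕ, 0 < n → θ₀ + (Real.sqrt n)⁻¹ • h ∈ Θ →
      IsLogLikelihoodRatio (𝓛 n) (ρ n (θ₀ + (Real.sqrt n)⁻¹ • h)) (ρ n θ₀)) ∧
    IsInfinitesimal (fun n => Sum.elim (X n) (Δ n)) (fun n => ρ n θ₀)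
      (Matrix.fromBlocks C τ τᴴ J)
      (fun n => 𝓛 n - (∑ i, (h i : ℂ) • Δ n i
        - (1 / 2 * ∑ i, ∑ j, J i j * (h i : ℂ) * (h j : ℂ)) • (1 : Matrix (N n) (N n) ℂ)))

end Sequences

end QLAN

end

/-!
Since traces factor over tensor products,
`Tr ρ^{⊗n} ∏ₜ exp (√-1 Yₜ⁽ⁿ⁾) = (Tr ρ ∏ₜ exp (√-1 Yₜ / √n)) ^ n` for normalized sums `Yₜ⁽ⁿ⁾`.
The second-order expansion of the ordered product inside, together with
`(1 + zₙ / n) ^ n → exp z` for `zₙ → z`, produces the Gaussian quasi-characteristic function; a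
first-order perturbation `ρ + ρ' / √n` of the state only adds the drift `Tr ρ' Y`.

The singular part of `ρ_{θ₀+h}` is positive semidefinite, so its norm is controlled by its trace
`1 - Tr ρ_{θ₀} exp 𝓛_h`, which is negligible. Hence the model is differentiable at `θ₀`, and its
derivative is the Jordan product of `ρ_{θ₀}` with the derivative of `𝓛`: the partial derivatives of
`𝓛` are symmetric logarithmic derivatives. Any other choice differs from these by Hermitian `K`
with `ρ_{θ₀} K = 0`, and such `K` does not contribute to any of the limiting traces.

For the tensor powers, `∑ₖ I ⊗ ⋯ ⊗ 𝓛_{h/√n} ⊗ ⋯ ⊗ I` is a version of the log-likelihood ratio, and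
`Tr ρ_{θ₀} exp 𝓛_h = 1 - o(‖h‖²)` forces its expectation to converge to `-½ hᵀ J h`. So it is the
normalized sum of the `hⁱ Lᵢ` minus this constant, up to a normalized sum whose summand converges
to such a `K` and has vanishing drift; that remainder is infinitesimal.
-/

noncomputable section

namespace QLAN

section PositiveSemidefinite

variable {m n p 𝕜 : Type*} [Fintype n] [RCLike 𝕜]

theorem exists_eq_conjTranspose_mul_self {A : Matrix n n 𝕜} (hA : A.PosSemidef) :
    ∃ C : Matrix n n 𝕜, A = Cᴴ * C := by
  classical
  open scoped MatrixOrder in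
  exact CStarAlgebra.nonneg_iff_eq_star_mul_self.1 (Matrix.nonneg_iff_posSemidef.2 hA)

theorem mul_eq_zero_of_trace_conj_eq_zero [Fintype m] {A : Matrix n n 𝕜} (hA : A.PosSemidef)
    {K : Matrix n m 𝕜} (h : (Kᴴ * A * K).trace = 0) : A * K = 0 := by
  obtain ⟨C, rfl⟩ := exists_eq_conjTranspose_mul_self hA
  have hCK : ((C * K)ᴴ * (C * K)).trace = 0 := by
    rw [← h, Matrix.conjTranspose_mul]
    simp only [Matrix.mul_assoc]
  rw [Matrix.mul_assoc, Matrix.trace_conjTranspose_mul_self_eq_zero_iff.1 hCK, Matrix.mul_zero]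

open scoped Matrix.Norms.Frobenius in
theorem frobenius_norm_le_norm_trace {A : Matrix n n 𝕜} (hA : A.PosSemidef) :
    ‖A‖ ≤ ‖A.trace‖ := by
  obtain ⟨C, rfl⟩ := exists_eq_conjTranspose_mul_self hA
  have htrace : (Cᴴ * C).trace = ((∑ i, ∑ j, ‖C i j‖ ^ 2 : ℝ) : 𝕜) := by
    rw [Finset.sum_comm]
    simp [Matrix.trace, Matrix.mul_apply, RCLike.conj_mul]
  calc ‖Cᴴ * C‖ ≤ ‖C‖ * ‖C‖ := by
        simpa using Matrix.frobenius_norm_mul Cᴴ C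
    _ = ∑ i, ∑ j, ‖C i j‖ ^ 2 := by
        rw [Matrix.frobenius_norm_def, ← Real.sqrt_eq_rpow,
          Real.mul_self_sqrt (by positivity)]
        simp
    _ = ‖(Cᴴ * C).trace‖ := by
        rw [htrace, RCLike.norm_ofReal, abs_of_nonneg (by positivity)]

theorem exists_mul_eq_of_ker_le {K : Type*} [Field K] [Fintype m] {A : Matrix m n K}
    {C : Matrix p n K} (h : ∀ v, A *ᵥ v = 0 → C *ᵥ v = 0) : ∃ M : Matrix p m K, M * A = C := by
  classical
  have hker : LinearMap.ker A.toLin' ≤ LinearMap.ker C.toLin' := fun v hv => h v hv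
  obtain ⟨g, hg⟩ := (A.toLin'.ker.liftQ A.toLin' le_rfl).exists_leftInverse_of_injective
    (Submodule.ker_liftQ_eq_bot _ _ _ le_rfl)
  refine ⟨LinearMap.toMatrix' (A.toLin'.ker.liftQ C.toLin' hker ∘ₗ g), Matrix.toLin'.injective ?_⟩
  rw [Matrix.toLin'_mul, Matrix.toLin'_toMatrix']
  refine LinearMap.ext fun v => ?_
  exact congrArg (A.toLin'.ker.liftQ C.toLin' hker)
    (LinearMap.congr_fun hg (Submodule.Quotient.mk v))

end PositiveSemidefinite

section AbsoluteContinuity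

variable {ι : Type*} [Fintype ι] [DecidableEq ι] {ρ σ : Matrix ι ι ℂ}

theorem mem_supp_iff (hρ : ρ.IsHermitian) {x : EuclideanSpace ℂ ι} :
    x ∈ supp ρ ↔ ∃ v, ρ *ᵥ v = x.ofLp := by
  have hadj : LinearMap.adjoint (Matrix.toEuclideanLin ρ) = Matrix.toEuclideanLin ρ := by
    rw [← Matrix.toEuclideanLin_conjTranspose_eq_adjoint, hρ.eq]
  rw [supp, LinearMap.orthogonal_ker, hadj, LinearMap.mem_range]
  exact ⟨fun ⟨y, hy⟩ => ⟨y.ofLp, congrArg WithLp.ofLp hy⟩,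
    fun ⟨v, hv⟩ => ⟨WithLp.toLp 2 v, WithLp.ofLp_injective 2 hv⟩⟩

theorem inner_excision (σ ρ : Matrix ι ι ℂ) (x y : supp ρ) :
    inner ℂ x (excision σ ρ y) = star x.1.ofLp ⬝ᵥ (σ *ᵥ y.1.ofLp) := by
  rw [excision, LinearMap.comp_apply, LinearMap.adjoint_inner_right,
    EuclideanSpace.inner_eq_star_dotProduct, dotProduct_comm]
  rfl

theorem isSymmetric_excision (hσ : σ.IsHermitian) (ρ : Matrix ι ι ℂ) :
    LinearMap.IsSymmetric (𝕜 := ℂ) (E := supp ρ) (excision σ ρ) := fun x y => by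
  rw [← inner_conj_symm, inner_excision, inner_excision, starRingEnd_apply,
    Matrix.star_dotProduct, Matrix.star_mulVec, hσ.eq, Matrix.dotProduct_mulVec, star_star]

theorem absCont_iff_forall_mulVec (hρ : ρ.IsHermitian) (hσ : σ.PosSemidef) :
    AbsCont ρ σ ↔ ∀ v, (σ * ρ) *ᵥ v = 0 → ρ *ᵥ v = 0 := by
  constructor
  · rintro ⟨-, hpos⟩ v hv
    by_contra hne
    have hx := hpos ⟨WithLp.toLp 2 (ρ *ᵥ v), (mem_supp_iff hρ).2 ⟨v, rfl⟩⟩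
      fun h0 => hne (congrArg (fun z : supp ρ => z.1.ofLp) h0)
    rw [inner_excision, Matrix.mulVec_mulVec, hv, dotProduct_zero] at hx
    exact lt_irrefl _ hx
  · refine fun h => ⟨isSymmetric_excision hσ.isHermitian ρ, fun x hx => ?_⟩
    obtain ⟨v, hv⟩ := (mem_supp_iff hρ).1 x.2
    have hne : star x.1.ofLp ⬝ᵥ (σ *ᵥ x.1.ofLp) ≠ 0 := fun h0 => hx <| by
      rw [hσ.dotProduct_mulVec_zero_iff, ← hv, Matrix.mulVec_mulVec] at h0
      exact Subtype.ext (WithLp.ofLp_injective 2 (hv.symm.trans (h v h0)))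
    rw [inner_excision]
    exact (Complex.pos_iff.1 ((hσ.dotProduct_mulVec_nonneg _).lt_of_ne' hne)).1

theorem absCont_iff_exists_mul_eq (hρ : ρ.IsHermitian) (hσ : σ.PosSemidef) :
    AbsCont ρ σ ↔ ∃ M : Matrix ι ι ℂ, M * (σ * ρ) = ρ := by
  rw [absCont_iff_forall_mulVec hρ hσ]
  refine ⟨exists_mul_eq_of_ker_le, ?_⟩
  rintro ⟨M, hM⟩ v hv
  rw [← hM, ← Matrix.mulVec_mulVec, hv, Matrix.mulVec_zero]

theorem singular_iff_mul_eq_zero (hρ : ρ.IsHermitian) (hσ : σ.PosSemidef) :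
    Singular ρ σ ↔ σ * ρ = 0 := by
  constructor
  · refine fun h => Matrix.toLin'.injective (LinearMap.ext fun v => ?_)
    let x : supp ρ := ⟨WithLp.toLp 2 (ρ *ᵥ v), (mem_supp_iff hρ).2 ⟨v, rfl⟩⟩
    have hx : star (ρ *ᵥ v) ⬝ᵥ (σ *ᵥ (ρ *ᵥ v)) = 0 := by
      rw [← inner_excision σ ρ x x, h]
      exact inner_zero_right (𝕜 := ℂ) x
    simpa using (hσ.dotProduct_mulVec_zero_iff _).1 hx
  · refine fun h => LinearMap.ext fun y => ext_inner_left ℂ fun x => ?_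
    obtain ⟨v, hv⟩ := (mem_supp_iff hρ).1 y.2
    rw [inner_excision, ← hv, Matrix.mulVec_mulVec, h, Matrix.zero_mulVec, dotProduct_zero]
    exact (inner_zero_right _).symm

end AbsoluteContinuity

section Tensor

variable {ι : Type*} {n : ℕ}

theorem tensor_one [DecidableEq ι] : tensor (1 : Fin n → Matrix ι ι ℂ) = 1 := by
  ext x y
  simp only [tensor, Matrix.of_apply, Pi.one_apply, Matrix.one_apply, Finset.prod_ite_zero,
    funext_iff, Finset.mem_univ, true_imp_iff, Finset.prod_const_one]

theorem tensor_conjTranspose (A : Fin n → Matrix ι ι ℂ) :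
    (tensor A)ᴴ = tensor fun k => (A k)ᴴ := by
  ext x y
  simp only [tensor, Matrix.conjTranspose_apply, Matrix.of_apply, star_prod]

theorem isHermitian_tensor {A : Fin n → Matrix ι ι ℂ} (hA : ∀ k, (A k).IsHermitian) :
    (tensor A).IsHermitian :=
  (tensor_conjTranspose A).trans (congrArg tensor (funext hA))

theorem isHermitian_tensorPow {A : Matrix ι ι ℂ} (hA : A.IsHermitian) :
    (tensorPow n A).IsHermitian :=
  isHermitian_tensor fun _ => hA

/-- `tensor` as a multilinear map of its factors. -/
def tensorMultilinear (ι : Type*) (n : ℕ) :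
    MultilinearMap ℂ (fun _ : Fin n => Matrix ι ι ℂ) (Matrix (Fin n → ι) (Fin n → ι) ℂ) where
  toFun := tensor
  map_update_add' A k B C := by
    ext x y
    exact ((MultilinearMap.mkPiAlgebra ℂ (Fin n) ℂ).compLinearMap
      fun j => Matrix.entryLinearMap ℂ ℂ (x j) (y j)).map_update_add A k B C
  map_update_smul' A k c B := by
    ext x y
    exact ((MultilinearMap.mkPiAlgebra ℂ (Fin n) ℂ).compLinearMap
      fun j => Matrix.entryLinearMap ℂ ℂ (x j) (y j)).map_update_smul A k c B

theorem tensor_mul [Fintype ι] (A C : Fin n → Matrix ι ι ℂ) :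
    tensor A * tensor C = tensor (A * C) := by
  ext x y
  simp only [tensor, Matrix.mul_apply, Matrix.of_apply, Pi.mul_apply, ← Finset.prod_mul_distrib,
    Finset.prod_univ_sum, Fintype.piFinset_univ]

theorem posSemidef_tensor [Finite ι] {A : Fin n → Matrix ι ι ℂ} (hA : ∀ k, (A k).PosSemidef) :
    (tensor A).PosSemidef := by
  cases nonempty_fintype ι
  choose C hC using fun k => exists_eq_conjTranspose_mul_self (hA k)
  have hfactor : tensor A = (tensor C)ᴴ * tensor C := by
    rw [tensor_conjTranspose, tensor_mul]
    exact congrArg tensor (funext hC)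
  rw [hfactor]
  exact Matrix.posSemidef_conjTranspose_mul_self _

theorem posSemidef_tensor_add_sub [Finite ι] {A C : Fin n → Matrix ι ι ℂ}
    (hA : ∀ k, (A k).PosSemidef) (hC : ∀ k, (C k).PosSemidef) :
    (tensor (A + C) - tensor A).PosSemidef := by
  have hexpand : tensor (A + C) - tensor A =
      ∑ s ∈ (Finset.univ : Finset (Finset (Fin n))).erase Finset.univ,
        tensor (s.piecewise A C) := by
    have hsum : tensor (A + C) = ∑ s : Finset (Fin n), tensor (s.piecewise A C) :=
      (tensorMultilinear ι n).map_add_univ A C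
    rw [hsum, ← Finset.add_sum_erase _ _ (Finset.mem_univ Finset.univ), Finset.piecewise_univ,
      add_sub_cancel_left]
  rw [hexpand]
  refine Matrix.posSemidef_sum _ fun s _ => posSemidef_tensor fun k => ?_
  exact s.piecewise_cases A C (fun B : Matrix ι ι ℂ => B.PosSemidef) (hA k) (hC k)

theorem posSemidef_tensorPow [Finite ι] {A : Matrix ι ι ℂ} (hA : A.PosSemidef) :
    (tensorPow n A).PosSemidef :=
  posSemidef_tensor fun _ => hA

section NormalizedSum

variable [DecidableEq ι]

theorem isHermitian_tensor_mulSingle (k : Fin n) {B : Matrix ι ι ℂ} (hB : B.IsHermitian) :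
    (tensor (Pi.mulSingle k B)).IsHermitian :=
  isHermitian_tensor <| (Function.forall_update_iff _ fun _ (M : Matrix ι ι ℂ) => M.IsHermitian).2
    ⟨hB, fun _ _ => Matrix.isHermitian_one⟩

theorem isHermitian_normalizedSum {B : Matrix ι ι ℂ} (hB : B.IsHermitian) :
    (normalizedSum n B).IsHermitian := by
  rw [normalizedSum, ← Complex.ofReal_inv, Complex.coe_smul]
  exact IsSelfAdjoint.smul (IsSelfAdjoint.all _)
    (isSelfAdjoint_sum _ fun k _ => isHermitian_tensor_mulSingle k hB)

/-- `normalizedSum n` as a linear map. -/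
def normalizedSumLinear (ι : Type*) [DecidableEq ι] (n : ℕ) :
    Matrix ι ι ℂ →ₗ[ℂ] Matrix (Fin n → ι) (Fin n → ι) ℂ :=
  ((Real.sqrt n : ℝ) : ℂ)⁻¹ • ∑ k : Fin n, (tensorMultilinear ι n).toLinearMap 1 k

theorem coe_normalizedSumLinear (n : ℕ) :
    ⇑(normalizedSumLinear ι n) = normalizedSum n := by
  ext1 B
  rw [normalizedSumLinear, LinearMap.smul_apply, LinearMap.sum_apply]
  rfl

theorem sum_smul_normalizedSum {κ : Type*} [Fintype κ] (n : ℕ) (Z : κ → Matrix ι ι ℂ)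
    (ξ : κ → ℂ) : ∑ i, ξ i • normalizedSum n (Z i) = normalizedSum n (∑ i, ξ i • Z i) := by
  simp only [← coe_normalizedSumLinear, map_sum, map_smul]

theorem one_eq_normalizedSum (hn : n ≠ 0) :
    (1 : Matrix (Fin n → ι) (Fin n → ι) ℂ) = normalizedSum n ((Real.sqrt n)⁻¹ • 1) := by
  have hscale : (Real.sqrt n : ℂ)⁻¹ * ((Real.sqrt n : ℂ)⁻¹ * n) = 1 := by
    have hsqrt : (Real.sqrt n : ℂ) ≠ 0 := by simpa using hn
    field_simp
    exact_mod_cast (Real.sq_sqrt n.cast_nonneg).symm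
  have hone : normalizedSum n (1 : Matrix ι ι ℂ) = ((Real.sqrt n : ℂ)⁻¹ * n) • 1 := by
    simp only [normalizedSum, ← Pi.one_def, Function.update_eq_self_iff.2, Pi.one_apply,
      tensor_one, Finset.sum_const, Finset.card_univ, Fintype.card_fin]
    rw [← Nat.cast_smul_eq_nsmul ℂ, smul_smul]
  rw [← Complex.coe_smul, Complex.ofReal_inv, ← coe_normalizedSumLinear, map_smul,
    coe_normalizedSumLinear, hone, smul_smul, hscale, one_smul]

end NormalizedSum

variable [Fintype ι]

theorem trace_tensor (A : Fin n → Matrix ι ι ℂ) : (tensor A).trace = ∏ k, (A k).trace := by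
  simp only [tensor, Matrix.trace, Matrix.diag_apply, Matrix.of_apply, Finset.prod_univ_sum,
    Fintype.piFinset_univ]

theorem tensorPow_mul (A C : Matrix ι ι ℂ) :
    tensorPow n A * tensorPow n C = tensorPow n (A * C) :=
  tensor_mul _ _

theorem trace_tensorPow (A : Matrix ι ι ℂ) : (tensorPow n A).trace = A.trace ^ n := by
  simp [tensorPow, trace_tensor]

theorem isDensity_tensorPow {ρ : Matrix ι ι ℂ} (hρ : IsDensity ρ) :
    IsDensity (tensorPow n ρ) :=
  ⟨posSemidef_tensorPow hρ.posSemidef, by simp [trace_tensorPow, hρ.trace_eq_one]⟩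

variable [DecidableEq ι]

/-- `tensor` as a monoid homomorphism, for the factorwise product. -/
def tensorMonoidHom (ι : Type*) [Fintype ι] [DecidableEq ι] (n : ℕ) :
    (Fin n → Matrix ι ι ℂ) →* Matrix (Fin n → ι) (Fin n → ι) ℂ where
  toFun := tensor
  map_one' := tensor_one
  map_mul' A C := (tensor_mul A C).symm

/-- The amplification `B ↦ I^{⊗(k-1)} ⊗ B ⊗ I^{⊗(n-k)}` of an operator on the `k`-th factor. -/
def embed (k : Fin n) : Matrix ι ι ℂ →ₐ[ℂ] Matrix (Fin n → ι) (Fin n → ι) ℂ :=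
  AlgHom.ofLinearMap ((tensorMultilinear ι n).toLinearMap 1 k)
    (map_one ((tensorMonoidHom ι n).comp (MonoidHom.mulSingle _ k)))
    (map_mul ((tensorMonoidHom ι n).comp (MonoidHom.mulSingle _ k)))

theorem embed_apply (k : Fin n) (B : Matrix ι ι ℂ) : embed k B = tensor (Pi.mulSingle k B) := rfl

theorem isHermitian_sum_embed {B : Matrix ι ι ℂ} (hB : B.IsHermitian) :
    (∑ k : Fin n, embed k B).IsHermitian :=
  isSelfAdjoint_sum _ fun k _ => isHermitian_tensor_mulSingle k hB

theorem commute_embed {j k : Fin n} (hjk : j ≠ k) (B C : Matrix ι ι ℂ) :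
    Commute (embed j B) (embed k C) := by
  rw [embed_apply, embed_apply]
  exact (Pi.mulSingle_commute (f := fun _ => Matrix ι ι ℂ) hjk B C).map (tensorMonoidHom ι n)

theorem exp_embed (k : Fin n) (B : Matrix ι ι ℂ) :
    NormedSpace.exp (embed k B) = embed k (NormedSpace.exp B) := by
  have hcont : Continuous (embed (ι := ι) k) :=
    LinearMap.continuous_of_finiteDimensional (embed (ι := ι) k).toLinearMap
  open scoped Matrix.Norms.Operator in
  exact (NormedSpace.map_exp (embed (ι := ι) k) hcont B).symm

theorem exp_sum_embed (B : Matrix ι ι ℂ) :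
    NormedSpace.exp (∑ k : Fin n, embed k B) = tensorPow n (NormedSpace.exp B) := by
  rw [Matrix.exp_sum_of_commute _ _ fun j _ k _ hjk => commute_embed hjk B B]
  simp only [exp_embed]
  simp only [embed_apply]
  exact (Finset.map_noncommProd _ _ _ (tensorMonoidHom ι n)).symm.trans
    (congrArg tensor (Finset.noncommProd_mulSingle fun _ => NormedSpace.exp B))

theorem prod_ofFn_tensorPow {s : ℕ} (E : Fin s → Matrix ι ι ℂ) :
    (List.ofFn fun t => tensorPow n (E t)).prod = tensorPow n (List.ofFn E).prod := by
  have h := map_list_prod ((tensorMonoidHom ι n).comp (Pi.constMonoidHom _ _)) (List.ofFn E)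
  rw [List.map_ofFn] at h
  exact h.symm

theorem normalizedSum_eq_smul_sum_embed (n : ℕ) (B : Matrix ι ι ℂ) :
    normalizedSum n B = (Real.sqrt n)⁻¹ • ∑ k : Fin n, embed k B := by
  rw [normalizedSum, ← Complex.ofReal_inv, Complex.coe_smul]
  rfl

theorem sum_embed_eq_normalizedSum (hn : n ≠ 0) (B : Matrix ι ι ℂ) :
    ∑ k : Fin n, embed k B = normalizedSum n (Real.sqrt n • B) := by
  have hsqrt : Real.sqrt n ≠ 0 := by simpa using hn
  rw [normalizedSum_eq_smul_sum_embed]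
  simp only [← Complex.coe_smul, map_smul, ← Finset.smul_sum]
  rw [Complex.coe_smul, Complex.coe_smul, inv_smul_smul₀ hsqrt]

theorem exp_smul_normalizedSum (c : ℂ) (B : Matrix ι ι ℂ) :
    NormedSpace.exp (c • normalizedSum n B) =
      tensorPow n (NormedSpace.exp ((Real.sqrt n)⁻¹ • c • B)) := by
  rw [← exp_sum_embed, normalizedSum_eq_smul_sum_embed, smul_comm]
  simp only [← Complex.coe_smul, map_smul, Finset.smul_sum]

theorem trace_tensorPow_mul_prod_exp {s : ℕ} (ρ : Matrix ι ι ℂ) (Y : Fin s → Matrix ι ι ℂ) :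
    (tensorPow n ρ *
      (List.ofFn fun t => NormedSpace.exp (Complex.I • normalizedSum n (Y t))).prod).trace =
    (ρ * (List.ofFn fun t =>
      NormedSpace.exp ((Real.sqrt n)⁻¹ • Complex.I • Y t)).prod).trace ^ n := by
  simp only [exp_smul_normalizedSum, prod_ofFn_tensorPow, tensorPow_mul, trace_tensorPow]

theorem absCont_tensorPow {ρ σ : Matrix ι ι ℂ} (hρ : ρ.IsHermitian) (hσ : σ.PosSemidef)
    (h : AbsCont ρ σ) : AbsCont (tensorPow n ρ) (tensorPow n σ) := by
  obtain ⟨M, hM⟩ := (absCont_iff_exists_mul_eq hρ hσ).1 h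
  refine (absCont_iff_exists_mul_eq (isHermitian_tensorPow hρ) (posSemidef_tensorPow hσ)).2
    ⟨tensorPow n M, ?_⟩
  simp only [tensorPow_mul, hM]

theorem isLebesgueDecomp_tensorPow {ρ σ σa σs : Matrix ι ι ℂ} (hρ : ρ.PosSemidef)
    (h : IsLebesgueDecomp σ ρ σa σs) :
    IsLebesgueDecomp (tensorPow n σ) (tensorPow n ρ) (tensorPow n σa)
      (tensorPow n σ - tensorPow n σa) := by
  have hsing : (tensorPow n σ - tensorPow n σa).PosSemidef := by
    rw [h.eq_add]
    exact posSemidef_tensor_add_sub (fun _ => h.posSemidef_ac) fun _ => h.posSemidef_sing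
  have hmul : ρ * σ = ρ * σa := by
    rw [h.eq_add, mul_add, (singular_iff_mul_eq_zero h.posSemidef_sing.isHermitian hρ).1 h.singular,
      add_zero]
  refine ⟨(add_sub_cancel _ _).symm, posSemidef_tensorPow h.posSemidef_ac, hsing,
    absCont_tensorPow h.posSemidef_ac.isHermitian hρ h.absCont,
    (singular_iff_mul_eq_zero hsing.isHermitian (posSemidef_tensorPow hρ)).2 ?_⟩
  rw [mul_sub, tensorPow_mul, tensorPow_mul, hmul, sub_self]

theorem isLogLikelihoodRatio_tensorPow {L ρ σ : Matrix ι ι ℂ} (hρ : ρ.PosSemidef)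
    (h : IsLogLikelihoodRatio L σ ρ) :
    IsLogLikelihoodRatio (∑ k : Fin n, embed k L) (tensorPow n σ) (tensorPow n ρ) := by
  obtain ⟨hL, σa, σs, hdecomp, hσa⟩ := h
  refine ⟨isHermitian_sum_embed hL, tensorPow n σa, _, isLebesgueDecomp_tensorPow hρ hdecomp, ?_⟩
  simp only [Finset.smul_sum, ← map_smul, exp_sum_embed, tensorPow_mul, hσa]

end Tensor

section SecondOrderExpansion

variable {α 𝕜 𝔸 : Type*} {l : Filter α} {ε : α → 𝕜} {E F a c : α → 𝔸} {a₀ b c₀ d : 𝔸}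

theorem exp_sub_quadratic_isBigO [RCLike 𝕜] [NormedRing 𝔸] [NormedAlgebra 𝕜 𝔸] [CompleteSpace 𝔸] :
    (fun y : 𝔸 => NormedSpace.exp y - (1 + y + (1 / 2 : 𝕜) • (y * y)))
      =O[𝓝 0] fun y => ‖y‖ ^ 3 := by
  have h := (NormedSpace.exp_hasFPowerSeriesAt_zero (𝕂 := 𝕜) (𝔸 := 𝔸)).isBigO_sub_partialSum_pow 3
  simpa [FormalMultilinearSeries.partialSum, Finset.sum_range_succ,
    NormedSpace.expSeries_apply_eq, pow_two] using h

/-- The second-order expansion `E = 1 + ε a + ε² b + o(ε²)` along `l`, where the first-order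
coefficient `a` may vary and tends to `a₀`. Only the limit `a₀` enters the second-order terms of
products, but `a` itself must be recorded, since it is multiplied by the larger factor `ε`. -/
structure HasExpansion [Field 𝕜] [Ring 𝔸] [Algebra 𝕜 𝔸] [TopologicalSpace 𝔸] (l : Filter α)
    (ε : α → 𝕜) (E a : α → 𝔸) (a₀ b : 𝔸) : Prop where
  tendsto_fst : Tendsto a l (𝓝 a₀)
  tendsto_snd : Tendsto (fun x => (ε x ^ 2)⁻¹ • (E x - 1 - ε x • a x)) l (𝓝 b)

namespace HasExpansion

section Algebra

variable [Field 𝕜] [Ring 𝔸] [Algebra 𝕜 𝔸] [TopologicalSpace 𝔸]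

theorem one : HasExpansion l ε (1 : α → 𝔸) 0 0 0 :=
  ⟨tendsto_const_nhds, by simpa using tendsto_const_nhds⟩

variable [TopologicalSpace 𝕜] [IsTopologicalRing 𝔸] [ContinuousSMul 𝕜 𝔸]

theorem tendsto_inv_smul_sub_one (hε : Tendsto ε l (𝓝[≠] 0)) (hE : HasExpansion l ε E a a₀ b) :
    Tendsto (fun x => (ε x)⁻¹ • (E x - 1)) l (𝓝 a₀) := by
  have hlim := hE.tendsto_fst.add
    ((tendsto_nhds_of_tendsto_nhdsWithin hε).smul hE.tendsto_snd)
  rw [zero_smul, add_zero] at hlim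
  refine hlim.congr' ?_
  filter_upwards [hε.eventually_mem self_mem_nhdsWithin] with x (hx : ε x ≠ 0)
  rw [smul_smul, show ε x * (ε x ^ 2)⁻¹ = (ε x)⁻¹ by field_simp, smul_sub _ (E x - 1),
    inv_smul_smul₀ hx, add_sub_cancel]

theorem tendsto_one (hε : Tendsto ε l (𝓝[≠] 0)) (hE : HasExpansion l ε E a a₀ b) :
    Tendsto E l (𝓝 1) := by
  have hlim := ((tendsto_nhds_of_tendsto_nhdsWithin hε).smul
    (hE.tendsto_inv_smul_sub_one hε)).add_const 1
  rw [zero_smul, zero_add] at hlim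
  refine hlim.congr' ?_
  filter_upwards [hε.eventually_mem self_mem_nhdsWithin] with x (hx : ε x ≠ 0)
  rw [smul_inv_smul₀ hx, sub_add_cancel]

theorem mul (hε : Tendsto ε l (𝓝[≠] 0)) (hE : HasExpansion l ε E a a₀ b)
    (hF : HasExpansion l ε F c c₀ d) :
    HasExpansion l ε (E * F) (a + c) (a₀ + c₀) (b + d + a₀ * c₀) := by
  refine ⟨hE.tendsto_fst.add hF.tendsto_fst, ?_⟩
  have hlim := (hE.tendsto_snd.add ((hE.tendsto_one hε).mul hF.tendsto_snd)).add
    ((hE.tendsto_inv_smul_sub_one hε).mul hF.tendsto_fst)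
  rw [one_mul] at hlim
  refine hlim.congr' ?_
  filter_upwards [hε.eventually_mem self_mem_nhdsWithin] with x (hx : ε x ≠ 0)
  have hsplit : (E * F) x - 1 - ε x • (a + c) x =
      (E x - 1 - ε x • a x) + E x * (F x - 1 - ε x • c x) + ε x • ((E x - 1) * c x) := by
    simp only [Pi.mul_apply, Pi.add_apply, sub_mul, mul_sub, smul_sub, smul_add,
      mul_smul_comm, mul_one, one_mul]
    abel
  rw [hsplit, smul_add, smul_add, mul_smul_comm, smul_smul,
    show (ε x ^ 2)⁻¹ * ε x = (ε x)⁻¹ by field_simp, smul_mul_assoc]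

theorem prod_ofFn (hε : Tendsto ε l (𝓝[≠] 0)) {s : ℕ} {E a : Fin s → α → 𝔸} {a₀ b : Fin s → 𝔸}
    (hE : ∀ t, HasExpansion l ε (E t) (a t) (a₀ t) (b t)) :
    HasExpansion l ε (fun x => (List.ofFn fun t => E t x).prod) (fun x => ∑ t, a t x) (∑ t, a₀ t)
      (∑ t, b t + ∑ t, ∑ u ∈ Finset.Ioi t, a₀ t * a₀ u) := by
  induction s with
  | zero => simpa using! one
  | succ s ih =>
    have h := (hE 0).mul hε (ih fun t => hE t.succ)
    simp only [List.ofFn_succ, List.prod_cons, Fin.sum_univ_succ, Fin.sum_Ioi_zero,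
      Fin.sum_Ioi_succ, ← Finset.mul_sum] at h ⊢
    convert! h using 1
    abel

end Algebra

theorem exp [RCLike 𝕜] [NormedRing 𝔸] [NormedAlgebra 𝕜 𝔸] [CompleteSpace 𝔸]
    (hε : Tendsto ε l (𝓝[≠] 0)) (ha : Tendsto a l (𝓝 a₀)) :
    HasExpansion l ε (fun x => NormedSpace.exp (ε x • a x)) a a₀ ((1 / 2 : 𝕜) • (a₀ * a₀)) := by
  refine ⟨ha, ?_⟩
  have hε₀ : Tendsto ε l (𝓝 0) := tendsto_nhds_of_tendsto_nhdsWithin hε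
  have hy : Tendsto (fun x => ε x • a x) l (𝓝 0) := by simpa using hε₀.smul ha
  have hyO : (fun x => ε x • a x) =O[l] ε := by
    simpa using (Asymptotics.isBigO_refl ε l).smul (ha.isBigO_one 𝕜)
  have hrem : (fun x => NormedSpace.exp (ε x • a x) -
      (1 + ε x • a x + (1 / 2 : 𝕜) • ((ε x • a x) * (ε x • a x)))) =o[l] fun x => ε x ^ 2 :=
    ((exp_sub_quadratic_isBigO.comp_tendsto hy).trans (hyO.norm_left.pow 3)).trans_isLittleO
      ((Asymptotics.isLittleO_pow_pow (by norm_num)).comp_tendsto hε₀)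
  have hlim := hrem.tendsto_inv_smul_nhds_zero.add
    ((ha.mul ha).const_smul (1 / 2 : 𝕜))
  rw [zero_add] at hlim
  refine hlim.congr' ?_
  filter_upwards [hε.eventually_mem self_mem_nhdsWithin] with x (hx : ε x ≠ 0)
  rw [← sub_sub, ← sub_sub, smul_sub _ (_ - _ - _), smul_mul_smul_comm, ← pow_two,
    smul_comm _ (ε x ^ 2), inv_smul_smul₀ (pow_ne_zero 2 hx), sub_add_cancel]

end HasExpansion

end SecondOrderExpansion

section CentralLimit

theorem HasExpansion.tendsto_trace_mul {α 𝕜 R ι : Type*} [Field 𝕜] [Ring R] [Algebra 𝕜 R]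
    [TopologicalSpace R] [IsTopologicalRing R] [Fintype ι] [DecidableEq ι] {l : Filter α}
    {ε : α → 𝕜} {E a ρ : α → Matrix ι ι R} {a₀ b ρ₀ : Matrix ι ι R}
    (hE : HasExpansion l ε E a a₀ b) (hρ : Tendsto ρ l (𝓝 ρ₀)) (htr : ∀ᶠ x in l, (ρ x).trace = 1) :
    Tendsto (fun x => (ε x ^ 2)⁻¹ • ((ρ x * E x).trace - 1) - (ε x)⁻¹ • (ρ x * a x).trace) l
      (𝓝 (ρ₀ * b).trace) := by
  have hlim := ((continuous_id.matrix_trace).tendsto _).comp (hρ.mul hE.tendsto_snd)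
  refine hlim.congr' ?_
  filter_upwards [htr] with x hx
  have hinv : (ε x ^ 2)⁻¹ * ε x = (ε x)⁻¹ := by
    rcases eq_or_ne (ε x) 0 with h | h
    · simp [h]
    · field_simp
  simp only [Function.comp_apply, id_eq, mul_smul_comm, mul_sub, mul_one, Matrix.trace_smul,
    Matrix.trace_sub, smul_sub, smul_smul, hinv, hx]

theorem tendsto_inv_sqrt_natCast : Tendsto (fun n : ℕ => (Real.sqrt n)⁻¹) atTop (𝓝[≠] 0) :=
  tendsto_nhdsWithin_iff.2
    ⟨tendsto_inv_atTop_zero.comp (Real.tendsto_sqrt_atTop.comp tendsto_natCast_atTop_atTop), by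
      filter_upwards [eventually_gt_atTop 0] with n hn
      exact inv_ne_zero (Real.sqrt_pos.2 (Nat.cast_pos.2 hn)).ne'⟩

variable {ι : Type*} [Fintype ι] [DecidableEq ι]

theorem HasExpansion.tendsto_trace_mul_pow {E a ρ : ℕ → Matrix ι ι ℂ} {a₀ b ρ₀ : Matrix ι ι ℂ}
    (hE : HasExpansion atTop (fun n : ℕ => (Real.sqrt n)⁻¹) E a a₀ b)
    (hρ : Tendsto ρ atTop (𝓝 ρ₀)) (htr : ∀ᶠ n in atTop, (ρ n).trace = 1) {m : ℂ}
    (hm : Tendsto (fun n : ℕ => Real.sqrt n • (ρ n * a n).trace) atTop (𝓝 m)) :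
    Tendsto (fun n => (ρ n * E n).trace ^ n) atTop (𝓝 (Complex.exp ((ρ₀ * b).trace + m))) := by
  have hlim : Tendsto (fun n : ℕ => (n : ℂ) * ((ρ n * E n).trace - 1)) atTop
      (𝓝 ((ρ₀ * b).trace + m)) := by
    refine ((hE.tendsto_trace_mul hρ htr).add hm).congr fun n => ?_
    rw [inv_inv, sub_add_cancel, inv_pow, inv_inv, Real.sq_sqrt n.cast_nonneg, Complex.real_smul,
      Complex.ofReal_natCast]
  simpa only [add_sub_cancel] using Complex.tendsto_one_add_pow_exp_of_tendsto hlim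

theorem tendsto_trace_tensorPow_mul_prod_exp {ρ : ℕ → Matrix ι ι ℂ} {ρ₀ : Matrix ι ι ℂ}
    (hρ : Tendsto ρ atTop (𝓝 ρ₀)) (htr : ∀ᶠ n in atTop, (ρ n).trace = 1) {s : ℕ}
    {Y : Fin s → ℕ → Matrix ι ι ℂ} {Y₀ : Fin s → Matrix ι ι ℂ} {c : Fin s → ℂ}
    (hY : ∀ t, Tendsto (Y t) atTop (𝓝 (Y₀ t)))
    (hc : ∀ t, Tendsto (fun n : ℕ => Real.sqrt n • (ρ n * Y t n).trace) atTop (𝓝 (c t))) :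
    Tendsto (fun n => (tensorPow n (ρ n) *
        (List.ofFn fun t => NormedSpace.exp (Complex.I • normalizedSum n (Y t n))).prod).trace)
      atTop (𝓝 (Complex.exp (∑ t, (Complex.I * c t - 1 / 2 * (ρ₀ * Y₀ t * Y₀ t).trace)
        - ∑ t, ∑ u ∈ Finset.Ioi t, (ρ₀ * Y₀ t * Y₀ u).trace))) := by
  have hsign (A C : Matrix ι ι ℂ) : (Complex.I • A) * (Complex.I • C) = -(A * C) := by
    rw [smul_mul_smul_comm, Complex.I_mul_I, neg_one_smul]
  have hfactor (t : Fin s) : HasExpansion atTop (fun n : ℕ => (Real.sqrt n)⁻¹)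
      (fun n => NormedSpace.exp ((Real.sqrt n)⁻¹ • Complex.I • Y t n)) (fun n => Complex.I • Y t n)
      (Complex.I • Y₀ t) (-((1 / 2 : ℂ) • (Y₀ t * Y₀ t))) := by
    have hexp := open scoped Matrix.Norms.Operator in
      HasExpansion.exp tendsto_inv_sqrt_natCast ((hY t).const_smul Complex.I)
    convert! hexp using 1
    rw [hsign, smul_neg, ← Complex.coe_smul]
    norm_num
  have hdrift : Tendsto (fun n : ℕ => Real.sqrt n •
      (ρ n * ∑ t, Complex.I • Y t n).trace) atTop (𝓝 (∑ t, Complex.I * c t)) := by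
    refine (tendsto_finsetSum _ fun t _ => (hc t).const_mul Complex.I).congr fun n => ?_
    simp only [Finset.mul_sum, Matrix.trace_sum, Finset.smul_sum, mul_smul_comm,
      Matrix.trace_smul, smul_eq_mul]
  have hlim := (HasExpansion.prod_ofFn tendsto_inv_sqrt_natCast hfactor).tendsto_trace_mul_pow
    hρ htr hdrift
  simp only [trace_tensorPow_mul_prod_exp]
  convert hlim using 3
  simp only [hsign, mul_add, mul_neg, Finset.mul_sum, mul_smul_comm, Matrix.trace_add,
    Matrix.trace_sum, Matrix.trace_neg, Matrix.trace_smul, ← Matrix.mul_assoc,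
    Finset.sum_sub_distrib, Finset.sum_neg_distrib, smul_eq_mul]
  abel

end CentralLimit

section Covariance

variable {ι κ κ' : Type*} [Fintype ι]

theorem star_trace_mul_mul {R : Type*} [CommSemiring R] [StarRing R] {ρ A C : Matrix ι ι R}
    (hρ : ρ.IsHermitian) (hA : A.IsHermitian) (hC : C.IsHermitian) :
    star (ρ * A * C).trace = (ρ * C * A).trace := by
  rw [← Matrix.trace_conjTranspose, Matrix.conjTranspose_mul, Matrix.conjTranspose_mul, hρ.eq,
    hA.eq, hC.eq, ← Matrix.mul_assoc, Matrix.trace_mul_comm, Matrix.mul_assoc]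

theorem covMatrix_conjTranspose {ρ : Matrix ι ι ℂ} (hρ : ρ.IsHermitian) {B : κ → Matrix ι ι ℂ}
    (hB : ∀ i, (B i).IsHermitian) {A : κ' → Matrix ι ι ℂ} (hA : ∀ i, (A i).IsHermitian) :
    (covMatrix ρ B A)ᴴ = covMatrix ρ A B := by
  ext i j
  exact star_trace_mul_mul hρ (hA i) (hB j)

theorem trace_mul_sum_mul_sum [Fintype κ] (ρ : Matrix ι ι ℂ) (Z : κ → Matrix ι ι ℂ)
    (ξ η : κ → ℂ) :
    (ρ * (∑ i, ξ i • Z i) * ∑ j, η j • Z j).trace =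
      ∑ i, ∑ j, ξ i * η j * covMatrix ρ Z Z j i := by
  simp only [Finset.mul_sum, Finset.sum_mul, Matrix.mul_smul, Matrix.smul_mul, Matrix.trace_sum,
    Matrix.trace_smul, smul_eq_mul, covMatrix, Matrix.of_apply]
  rw [Finset.sum_comm]
  exact Finset.sum_congr rfl fun i _ => Finset.sum_congr rfl fun j _ => by ring

theorem sum_sum_covMatrix_mul_mul [Fintype κ] (ρ : Matrix ι ι ℂ) (Z : κ → Matrix ι ι ℂ)
    (ξ η : κ → ℂ) :
    ∑ i, ∑ j, covMatrix ρ Z Z i j * ξ i * η j =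
      (ρ * (∑ j, η j • Z j) * ∑ i, ξ i • Z i).trace := by
  rw [trace_mul_sum_mul_sum, Finset.sum_comm]
  exact Finset.sum_congr rfl fun i _ => Finset.sum_congr rfl fun j _ => by ring

theorem posSemidef_covMatrix [Finite κ] {ρ : Matrix ι ι ℂ} (hρ : ρ.PosSemidef)
    {Z : κ → Matrix ι ι ℂ} (hZ : ∀ i, (Z i).IsHermitian) : (covMatrix ρ Z Z).PosSemidef := by
  cases nonempty_fintype κ
  refine Matrix.PosSemidef.of_dotProduct_mulVec_nonneg
    (covMatrix_conjTranspose hρ.isHermitian hZ hZ) fun x => ?_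
  have hadj : (∑ i, star (x i) • Z i)ᴴ = ∑ i, x i • Z i := by
    simp [Matrix.conjTranspose_sum, Matrix.conjTranspose_smul, (hZ _).eq]
  have hform : star x ⬝ᵥ (covMatrix ρ Z Z *ᵥ x) =
      ((∑ i, star (x i) • Z i) * ρ * (∑ i, star (x i) • Z i)ᴴ).trace := by
    rw [hadj, Matrix.mul_assoc, Matrix.trace_mul_comm, ← sum_sum_covMatrix_mul_mul]
    simp only [dotProduct, Matrix.mulVec, Pi.star_apply, Finset.mul_sum]
    exact Finset.sum_congr rfl fun i _ => Finset.sum_congr rfl fun j _ => by ring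
  rw [hform]
  exact (hρ.mul_mul_conjTranspose_same _).trace_nonneg

variable [Fintype κ]

theorem gaussianQuasiChar_covMatrix (m : κ → ℝ) (ρ : Matrix ι ι ℂ) (Z : κ → Matrix ι ι ℂ) {s : ℕ}
    (ξ : Fin s → κ → ℂ) :
    gaussianQuasiChar m (covMatrix ρ Z Z) ξ =
      Complex.exp (∑ t, (Complex.I * ∑ i, ξ t i * (m i : ℂ)
          - 1 / 2 * (ρ * (∑ i, ξ t i • Z i) * ∑ i, ξ t i • Z i).trace)
        - ∑ t, ∑ u ∈ Finset.Ioi t, (ρ * (∑ i, ξ t i • Z i) * ∑ i, ξ u i • Z i).trace) := by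
  simp only [gaussianQuasiChar, trace_mul_sum_mul_sum]

theorem convergesInLaw_normalizedSum [DecidableEq ι] {ρ : ℕ → Matrix ι ι ℂ} {ρ₀ : Matrix ι ι ℂ}
    (hρ₀ : ρ₀.PosSemidef) (hρ : Tendsto ρ atTop (𝓝 ρ₀)) (htr : ∀ᶠ n in atTop, (ρ n).trace = 1)
    {Z : κ → Matrix ι ι ℂ} (hZ : ∀ i, (Z i).IsHermitian) {m : κ → ℝ}
    (hm : ∀ i, Tendsto (fun n : ℕ => Real.sqrt n • (ρ n * Z i).trace) atTop (𝓝 (m i : ℂ))) :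
    ConvergesInLaw (fun n i => normalizedSum n (Z i)) (fun n => tensorPow n (ρ n)) m
      (covMatrix ρ₀ Z Z) := by
  refine ⟨posSemidef_covMatrix hρ₀ hZ, fun s ξ => ?_⟩
  simp only [sum_smul_normalizedSum]
  rw [gaussianQuasiChar_covMatrix]
  refine tendsto_trace_tensorPow_mul_prod_exp hρ htr (Y := fun t _ => ∑ i, ξ t i • Z i)
    (c := fun t => ∑ i, ξ t i * (m i : ℂ)) (fun t => tendsto_const_nhds) fun t => ?_
  refine (tendsto_finsetSum _ fun i _ => (hm i).const_mul (ξ t i)).congr fun n => ?_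
  simp only [Finset.mul_sum, Matrix.trace_sum, Matrix.trace_smul, Finset.smul_sum,
    mul_smul_comm, smul_eq_mul]

end Covariance

section JordanMultiplication

variable {ι : Type*} [Fintype ι]

/-- The Jordan multiplication `A ↦ (ρ A + A ρ) / 2` by `ρ`, as a real continuous linear map: a
symmetric logarithmic derivative is a Hermitian solution `S` of `jordanMul ρ S = ∂ρ`. -/
def jordanMul (ρ : Matrix ι ι ℂ) : Matrix ι ι ℂ →L[ℝ] Matrix ι ι ℂ where
  toLinearMap := (1 / 2 : ℝ) • (LinearMap.mulLeft ℝ ρ + LinearMap.mulRight ℝ ρ)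
  cont := by
    have h : Continuous fun A => (1 / 2 : ℝ) • (ρ * A + A * ρ) := by fun_prop
    exact h

theorem jordanMul_apply (ρ A : Matrix ι ι ℂ) :
    jordanMul ρ A = (1 / 2 : ℂ) • (ρ * A + A * ρ) := by
  have h : jordanMul ρ A = (1 / 2 : ℝ) • (ρ * A + A * ρ) := rfl
  rw [h, ← Complex.coe_smul]
  norm_num

theorem trace_jordanMul (ρ A : Matrix ι ι ℂ) : (jordanMul ρ A).trace = (ρ * A).trace := by
  rw [jordanMul_apply, Matrix.trace_smul, Matrix.trace_add, Matrix.trace_mul_comm A ρ, smul_eq_mul]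
  ring

theorem trace_jordanMul_mul {ρ A C : Matrix ι ι ℂ} (hρ : ρ.IsHermitian) (hA : A.IsHermitian)
    (hC : C.IsHermitian) : (jordanMul ρ A * C).trace = ((ρ * A * C).trace.re : ℂ) := by
  have hstar : (A * ρ * C).trace = star (ρ * A * C).trace := by
    rw [star_trace_mul_mul hρ hA hC, Matrix.mul_assoc, Matrix.trace_mul_comm]
  rw [jordanMul_apply, Matrix.smul_mul, Matrix.add_mul, Matrix.trace_smul, Matrix.trace_add, hstar,
    Complex.re_eq_add_conj, smul_eq_mul, starRingEnd_apply]
  ring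

theorem mul_eq_zero_of_jordanMul_eq_zero {ρ D : Matrix ι ι ℂ} (hρ : ρ.PosSemidef)
    (hD : D.IsHermitian) (h : jordanMul ρ D = 0) : ρ * D = 0 := by
  refine mul_eq_zero_of_trace_conj_eq_zero hρ ?_
  calc (Dᴴ * ρ * D).trace = (jordanMul ρ D * D).trace := by
        rw [hD.eq, jordanMul_apply, Matrix.smul_mul, Matrix.trace_smul, add_mul, Matrix.trace_add,
          Matrix.trace_mul_comm (ρ * D) D, ← Matrix.mul_assoc, smul_eq_mul]
        ring
    _ = 0 := by rw [h, Matrix.zero_mul, Matrix.trace_zero]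

end JordanMultiplication

section LikelihoodDerivative

variable {ι : Type*} [Fintype ι] [DecidableEq ι]

theorem trace_exp_half_mul_mul_exp_half (L ρ : Matrix ι ι ℂ) :
    (NormedSpace.exp ((1 / 2 : ℂ) • L) * ρ * NormedSpace.exp ((1 / 2 : ℂ) • L)).trace =
      (ρ * NormedSpace.exp L).trace := by
  rw [Matrix.mul_assoc, Matrix.trace_mul_comm, Matrix.mul_assoc,
    ← Matrix.exp_add_of_commute _ _ (Commute.refl _), ← add_smul]
  norm_num

open scoped Matrix.Norms.Frobenius in
/-- The singular part is positive semidefinite, so its trace controls its norm. -/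
theorem IsLogLikelihoodRatio.norm_sub_le {L σ ρ : Matrix ι ι ℂ} (h : IsLogLikelihoodRatio L σ ρ) :
    ‖σ - NormedSpace.exp ((1 / 2 : ℂ) • L) * ρ * NormedSpace.exp ((1 / 2 : ℂ) • L)‖ ≤
      ‖σ.trace - (ρ * NormedSpace.exp L).trace‖ := by
  obtain ⟨-, σa, σs, hdecomp, hσa⟩ := h
  rw [← trace_exp_half_mul_mul_exp_half, ← Matrix.trace_sub, ← hσa, hdecomp.eq_add,
    add_sub_cancel_left]
  exact frobenius_norm_le_norm_trace hdecomp.posSemidef_sing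

variable {V : Type*} [NormedAddCommGroup V] [NormedSpace ℝ V] {L σ : V → Matrix ι ι ℂ}
  {A : V →L[ℝ] Matrix ι ι ℂ}

theorem hasFDerivAt_exp_half_mul_mul_exp_half (ρ : Matrix ι ι ℂ) (hL0 : L 0 = 0)
    (hA : HasFDerivAt L A 0) :
    HasFDerivAt (fun h => NormedSpace.exp ((1 / 2 : ℂ) • L h) * ρ *
      NormedSpace.exp ((1 / 2 : ℂ) • L h)) ((jordanMul ρ).comp A) 0 := by
  open scoped Matrix.Norms.Frobenius in
  have hexp : HasFDerivAt (fun h => NormedSpace.exp ((1 / 2 : ℂ) • L h)) ((1 / 2 : ℂ) • A) 0 := by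
    have h0 : (1 / 2 : ℂ) • L 0 = 0 := by rw [hL0, smul_zero]
    have hzero := hasFDerivAt_exp_zero (𝕂 := ℝ) (𝔸 := Matrix ι ι ℂ)
    rw [← h0] at hzero
    exact hzero.comp 0 (hA.const_smul (1 / 2 : ℂ))
  open scoped Matrix.Norms.Frobenius in
  refine ((hexp.mul_const' ρ).mul' hexp).congr_fderiv (ContinuousLinearMap.ext fun v => ?_)
  change NormedSpace.exp ((1 / 2 : ℂ) • L 0) * ρ * ((1 / 2 : ℂ) • A v) +
    (1 / 2 : ℂ) • A v * ρ * NormedSpace.exp ((1 / 2 : ℂ) • L 0) = jordanMul ρ (A v)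
  rw [hL0, smul_zero, NormedSpace.exp_zero, one_mul, mul_one, mul_smul_comm, smul_mul_assoc,
    ← smul_add, jordanMul_apply]

theorem hasFDerivAt_of_isLogLikelihoodRatio (htr : ∀ᶠ h in 𝓝 0, (σ h).trace = 1)
    (hL : ∀ᶠ h in 𝓝 0, IsLogLikelihoodRatio (L h) (σ h) (σ 0)) (hL0 : L 0 = 0)
    (hA : HasFDerivAt L A 0)
    (hexp : (fun h => (σ 0 * NormedSpace.exp (L h)).trace - 1) =o[𝓝 0] fun h => h) :
    HasFDerivAt σ ((jordanMul (σ 0)).comp A) 0 := by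
  set σa : V → Matrix ι ι ℂ := fun h =>
    NormedSpace.exp ((1 / 2 : ℂ) • L h) * σ 0 * NormedSpace.exp ((1 / 2 : ℂ) • L h) with hσa
  have hσa0 : σ 0 = σa 0 := by simp [hσa, hL0]
  open scoped Matrix.Norms.Frobenius in
  have hsing : HasFDerivAt (fun h => σ h - σa h) (0 : V →L[ℝ] Matrix ι ι ℂ) 0 := by
    refine .of_isLittleO ?_
    have hle : (fun h => σ h - σa h) =O[𝓝 0] fun h => (σ 0 * NormedSpace.exp (L h)).trace - 1 := by
      refine .of_bound' ?_
      filter_upwards [htr, hL] with h hh hLh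
      rw [norm_sub_rev _ (1 : ℂ), ← hh]
      exact hLh.norm_sub_le
    refine (hle.trans_isLittleO hexp).congr (fun h => ?_) fun h => (sub_zero h).symm
    rw [← hσa0, sub_self, sub_zero]
    exact (sub_zero _).symm
  have hadd := hsing.add (hasFDerivAt_exp_half_mul_mul_exp_half (σ 0) hL0 hA)
  exact (hadd.congr_fderiv (zero_add _)).congr_of_eventuallyEq
    (.of_forall fun h => (sub_add_cancel _ _).symm)

theorem isSelfAdjoint_fderiv_apply {F : Type*} [NormedAddCommGroup F] [NormedSpace ℝ F]
    [StarAddMonoid F] [StarModule ℝ F] [ContinuousStar F] {f : V → F} {x : V} {f' : V →L[ℝ] F}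
    (hf : HasFDerivAt f f' x) (hsa : ∀ᶠ y in 𝓝 x, IsSelfAdjoint (f y)) (v : V) :
    IsSelfAdjoint (f' v) :=
  congrArg (fun g : V →L[ℝ] F => g v)
    ((hf.star.congr_of_eventuallyEq (hsa.mono fun _ hy => hy.symm)).unique hf)

end LikelihoodDerivative

section SymmetricLogarithmicDerivative

variable {ι : Type*}

theorem map_eq_sum_smul_single {d : ℕ} (A : Param d →L[ℝ] Matrix ι ι ℂ) (h : Param d) :
    A h = ∑ i, (h i : ℂ) • A (EuclideanSpace.single i 1) := by
  have hh : h = ∑ i, h i • EuclideanSpace.single i (1 : ℝ) := by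
    ext j
    simp [Pi.single_apply]
  conv_lhs => rw [hh, map_sum]
  exact Finset.sum_congr rfl fun i _ => by rw [map_smul, Complex.coe_smul]

theorem isHermitian_sum_ofReal_smul {κ : Type*} [Fintype κ] {S : κ → Matrix ι ι ℂ}
    (hS : ∀ i, (S i).IsHermitian) (h : κ → ℝ) : (∑ i, (h i : ℂ) • S i).IsHermitian := by
  rw [Matrix.IsHermitian, Matrix.conjTranspose_sum]
  simp [(hS _).eq]

variable [Fintype ι] {d : ℕ} {ρ : Param d → Matrix ι ι ℂ} {θ₀ : Param d}
  {ρ' : Param d →L[ℝ] Matrix ι ι ℂ}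

theorem isSLD_of_hasFDerivAt (hρ' : HasFDerivAt ρ ρ' θ₀) {i : Fin d} {S : Matrix ι ι ℂ}
    (hS : S.IsHermitian) (h : jordanMul (ρ θ₀) S = ρ' (EuclideanSpace.single i 1)) :
    IsSLD ρ θ₀ i S := by
  refine ⟨hS, ?_⟩
  rw [← jordanMul_apply, h]
  open scoped Matrix.Norms.Operator in
  exact hρ'.hasLineDerivAt _

theorem IsSLD.jordanMul_eq {i : Fin d} {S : Matrix ι ι ℂ} (hS : IsSLD ρ θ₀ i S)
    (hρ' : HasFDerivAt ρ ρ' θ₀) : jordanMul (ρ θ₀) S = ρ' (EuclideanSpace.single i 1) := by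
  rw [jordanMul_apply]
  open scoped Matrix.Norms.Operator in
  exact hS.2.unique (hρ'.hasLineDerivAt _)

theorem jordanMul_sum_smul_eq {S : Fin d → Matrix ι ι ℂ} (hS : ∀ i, IsSLD ρ θ₀ i (S i))
    (hρ' : HasFDerivAt ρ ρ' θ₀) (h : Param d) :
    jordanMul (ρ θ₀) (∑ i, (h i : ℂ) • S i) = ρ' h := by
  simp only [map_eq_sum_smul_single ρ' h, Complex.coe_smul, map_sum, map_smul,
    (hS _).jordanMul_eq hρ']

theorem IsSLD.trace_mul_eq_zero {i : Fin d} {S : Matrix ι ι ℂ} (hS : IsSLD ρ θ₀ i S)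
    (htr : ∀ᶠ θ in 𝓝 θ₀, (ρ θ).trace = 1) : (ρ θ₀ * S).trace = 0 := by
  have hline : Tendsto (fun t : ℝ => θ₀ + t • EuclideanSpace.single i (1 : ℝ)) (𝓝 0) (𝓝 θ₀) := by
    have hcont : Continuous fun t : ℝ => θ₀ + t • EuclideanSpace.single i (1 : ℝ) := by fun_prop
    simpa using hcont.tendsto 0
  have hderiv := hS.2
  rw [← jordanMul_apply] at hderiv
  have htrace : HasDerivAt (fun t : ℝ => (ρ (θ₀ + t • EuclideanSpace.single i 1)).trace)
      (jordanMul (ρ θ₀) S).trace 0 :=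
    open scoped Matrix.Norms.Operator in
    (Matrix.traceLinearMap ι ℝ ℂ).toContinuousLinearMap.hasFDerivAt.comp_hasDerivAt 0 hderiv
  rw [← trace_jordanMul]
  exact htrace.unique ((hasDerivAt_const 0 1).congr_of_eventuallyEq (hline.eventually htr))

theorem mul_sub_sum_smul_eq_zero_of_isSLD (hρ₀ : (ρ θ₀).PosSemidef)
    {A : Param d →L[ℝ] Matrix ι ι ℂ} (hA : ∀ h, (A h).IsHermitian)
    (hρ' : HasFDerivAt ρ ((jordanMul (ρ θ₀)).comp A) θ₀) {S : Fin d → Matrix ι ι ℂ}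
    (hS : ∀ i, IsSLD ρ θ₀ i (S i)) (h : Param d) :
    ρ θ₀ * (A h - ∑ i, (h i : ℂ) • S i) = 0 := by
  refine mul_eq_zero_of_jordanMul_eq_zero hρ₀
    ((hA h).sub (isHermitian_sum_ofReal_smul (fun i => (hS i).1) h)) ?_
  rw [map_sub, jordanMul_sum_smul_eq hS hρ', ContinuousLinearMap.comp_apply, sub_self]

theorem IsModel.eventually_mem [DecidableEq ι] {Θ : Set (Param d)} (hρ : IsModel Θ ρ)
    (hθ₀ : θ₀ ∈ Θ) : ∀ᶠ h in 𝓝 0, θ₀ + h ∈ Θ :=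
  (continuous_const_add θ₀).continuousAt.eventually_mem
    (by simpa using hρ.isOpen.mem_nhds hθ₀)

theorem IsModel.hasFDerivAt [DecidableEq ι] {Θ : Set (Param d)} (hρ : IsModel Θ ρ) (hθ₀ : θ₀ ∈ Θ)
    {L : Param d → Matrix ι ι ℂ}
    (hL : ∀ h, θ₀ + h ∈ Θ → IsLogLikelihoodRatio (L h) (ρ (θ₀ + h)) (ρ θ₀)) (hL0 : L 0 = 0)
    {A : Param d →L[ℝ] Matrix ι ι ℂ} (hA : HasFDerivAt L A 0)
    (htr : (fun h => (ρ θ₀ * NormedSpace.exp (L h)).trace - 1) =o[𝓝 0] fun h => h) :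
    HasFDerivAt ρ ((jordanMul (ρ θ₀)).comp A) θ₀ := by
  have hmem := hρ.eventually_mem hθ₀
  have hderiv := hasFDerivAt_of_isLogLikelihoodRatio (σ := fun h => ρ (θ₀ + h))
    (hmem.mono fun h hh => (hρ.isDensity _ hh).trace_eq_one)
    (by simpa only [add_zero] using hmem.mono hL) hL0 hA (by simpa only [add_zero] using htr)
  rw [add_zero] at hderiv
  have hshift : HasFDerivAt ρ ((jordanMul (ρ θ₀)).comp A) (θ₀ + 0) := by
    open scoped Matrix.Norms.Operator in
    exact (hasFDerivAt_comp_add_left θ₀).1 hderiv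
  rwa [add_zero] at hshift

end SymmetricLogarithmicDerivative

section LocalAsymptoticNormality

theorem tendsto_sqrt_smul_sub {V F : Type*} [NormedAddCommGroup V] [NormedSpace ℝ V]
    [NormedAddCommGroup F] [NormedSpace ℝ F] {f : V → F} {f' : V →L[ℝ] F} {x : V}
    (hf : HasFDerivAt f f' x) (v : V) :
    Tendsto (fun n : ℕ => Real.sqrt n • (f (x + (Real.sqrt n)⁻¹ • v) - f x)) atTop (𝓝 (f' v)) :=
  hf.lim v (tendsto_norm_atTop_atTop.comp
    (Real.tendsto_sqrt_atTop.comp tendsto_natCast_atTop_atTop))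

theorem tendsto_add_inv_sqrt_smul {V : Type*} [NormedAddCommGroup V] [NormedSpace ℝ V] (x v : V) :
    Tendsto (fun n : ℕ => x + (Real.sqrt n)⁻¹ • v) atTop (𝓝 x) := by
  have hzero := (tendsto_inv_sqrt_natCast.mono_right nhdsWithin_le_nhds).smul_const v
  simpa using hzero.const_add x

theorem tendsto_natCast_smul_of_isLittleO {V F : Type*} [NormedAddCommGroup V] [NormedSpace ℝ V]
    [NormedAddCommGroup F] [NormedSpace ℝ F] {f : V → F}
    (hf : f =o[𝓝 0] fun v => ‖v‖ ^ 2) (v : V) :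
    Tendsto (fun n : ℕ => (n : ℝ) • f ((Real.sqrt n)⁻¹ • v)) atTop (𝓝 0) := by
  have hline : Tendsto (fun n : ℕ => (Real.sqrt n)⁻¹ • v) atTop (𝓝 0) := by
    simpa using tendsto_add_inv_sqrt_smul 0 v
  have hbound : (fun n : ℕ => ‖(Real.sqrt n)⁻¹ • v‖ ^ 2) =O[atTop] fun n : ℕ => (n : ℝ)⁻¹ := by
    refine .of_bound (‖v‖ ^ 2) (.of_forall fun n => le_of_eq ?_)
    simp [norm_smul, mul_pow, mul_comm]
  simpa using ((hf.comp_tendsto hline).trans_isBigO hbound).tendsto_inv_smul_nhds_zero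

theorem isHermitian_of_tendsto {α ι : Type*} {l : Filter α} [l.NeBot] {P : α → Matrix ι ι ℂ}
    {K : Matrix ι ι ℂ} (hP : Tendsto P l (𝓝 K)) (hPh : ∀ᶠ x in l, (P x).IsHermitian) :
    K.IsHermitian :=
  tendsto_nhds_unique (hP.star.congr' (hPh.mono fun _ hx => hx)) hP

theorem IsInfinitesimal.congr {N : ℕ → Type*} [∀ n, Fintype (N n)] [∀ n, DecidableEq (N n)]
    {κ : Type*} [Fintype κ] {X : ∀ n, κ → Matrix (N n) (N n) ℂ} {ρ : ∀ n, Matrix (N n) (N n) ℂ}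
    {J : Matrix κ κ ℂ} {R R' : ∀ n, Matrix (N n) (N n) ℂ} (hR : IsInfinitesimal X ρ J R)
    (h : ∀ᶠ n in atTop, R n = R' n) : IsInfinitesimal X ρ J R' := by
  refine ⟨hR.1, (h.and hR.2.1).mono fun n hn => hn.1 ▸ hn.2, fun s ξ η => ?_⟩
  refine (hR.2.2 s ξ η).congr' (h.mono fun n hn => ?_)
  simp only [hn]

variable {ι κ : Type*} [Fintype ι]

theorem mul_eq_zero_symm_of_isHermitian {R : Type*} [Semiring R] [StarRing R] {ρ K : Matrix ι ι R}
    (hρ : ρ.IsHermitian) (hK : K.IsHermitian) (h : ρ * K = 0) : K * ρ = 0 := by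
  simpa [Matrix.conjTranspose_mul, hρ.eq, hK.eq] using congrArg Matrix.conjTranspose h

theorem trace_jordanMul_sum_smul_mul {d : ℕ} {ρ : Matrix ι ι ℂ} (hρ : ρ.IsHermitian)
    {S : Fin d → Matrix ι ι ℂ} (hS : ∀ j, (S j).IsHermitian) {B : κ → Matrix ι ι ℂ}
    (hB : ∀ i, (B i).IsHermitian) (h : Param d) (i : κ) :
    (jordanMul ρ (∑ j, (h j : ℂ) • S j) * B i).trace =
      ((((covMatrix ρ B S).map Complex.re).mulVec h i : ℝ) : ℂ) := by
  rw [trace_jordanMul_mul hρ (isHermitian_sum_ofReal_smul hS h) (hB i)]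
  simp only [Matrix.mul_sum, Matrix.sum_mul, Matrix.mul_smul, Matrix.smul_mul, Matrix.trace_sum,
    Matrix.trace_smul, smul_eq_mul, Complex.re_sum, Complex.re_ofReal_mul, Matrix.mulVec,
    dotProduct, Matrix.map_apply, covMatrix, Matrix.of_apply,
    mul_comm _ (h _)]

theorem fromBlocks_covMatrix {κ' : Type*} {ρ : Matrix ι ι ℂ} (hρ : ρ.IsHermitian)
    {B : κ → Matrix ι ι ℂ} (hB : ∀ i, (B i).IsHermitian) {S : κ' → Matrix ι ι ℂ}
    (hS : ∀ i, (S i).IsHermitian) :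
    Matrix.fromBlocks (covMatrix ρ B B) (covMatrix ρ B S) (covMatrix ρ B S)ᴴ (covMatrix ρ S S) =
      covMatrix ρ (Sum.elim B S) (Sum.elim B S) := by
  rw [covMatrix_conjTranspose hρ hB hS]
  ext (i | i) (j | j) <;> rfl

theorem trace_mul_add_mul_add {R : Type*} [CommSemiring R] {ρ K : Matrix ι ι R} (h : ρ * K = 0)
    (h' : K * ρ = 0) (Y Y' : Matrix ι ι R) (η η' : R) :
    (ρ * (Y + η • K) * (Y' + η' • K)).trace = (ρ * Y * Y').trace := by
  have hYK : (ρ * Y * K).trace = 0 := by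
    rw [Matrix.trace_mul_comm, ← Matrix.mul_assoc, h', Matrix.zero_mul, Matrix.trace_zero]
  simp [Matrix.mul_add, h, hYK]

variable [DecidableEq ι]

theorem convergesInLaw_tensorPow_of_isSLD [Fintype κ] {d : ℕ} {Θ : Set (Param d)}
    {ρ : Param d → Matrix ι ι ℂ} (hρ : IsModel Θ ρ) {θ₀ : Param d} (hθ₀ : θ₀ ∈ Θ)
    {ρ' : Param d →L[ℝ] Matrix ι ι ℂ} (hρ' : HasFDerivAt ρ ρ' θ₀) {S : Fin d → Matrix ι ι ℂ}
    (hS : ∀ i, IsSLD ρ θ₀ i (S i)) {B : κ → Matrix ι ι ℂ} (hB : ∀ i, (B i).IsHermitian)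
    (hB0 : ∀ i, (ρ θ₀ * B i).trace = 0) (h : Param d) :
    ConvergesInLaw (fun n i => normalizedSum n (B i))
      (fun n => tensorPow n (ρ (θ₀ + (Real.sqrt n)⁻¹ • h)))
      (((covMatrix (ρ θ₀) B S).map Complex.re).mulVec h) (covMatrix (ρ θ₀) B B) := by
  have hρ₀ := hρ.isDensity θ₀ hθ₀
  have hline := tendsto_add_inv_sqrt_smul θ₀ h
  refine convergesInLaw_normalizedSum hρ₀.posSemidef (hρ'.continuousAt.tendsto.comp hline) ?_ hB
    fun i => ?_
  · filter_upwards [hline.eventually_mem (hρ.isOpen.mem_nhds hθ₀)] with n hn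
      using (hρ.isDensity _ hn).trace_eq_one
  · rw [← trace_jordanMul_sum_smul_mul hρ₀.posSemidef.isHermitian (fun j => (hS j).1) hB h i,
      jordanMul_sum_smul_eq hS hρ' h]
    have hslope : Tendsto (fun n : ℕ => Real.sqrt n • (ρ (θ₀ + (Real.sqrt n)⁻¹ • h) - ρ θ₀)) atTop
        (𝓝 (ρ' h)) :=
      open scoped Matrix.Norms.Operator in tendsto_sqrt_smul_sub hρ' h
    refine ((continuous_id.matrix_trace.tendsto _).comp (hslope.mul_const (B i))).congr fun n => ?_
    simp [Matrix.sub_mul, hB0 i]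

theorem isInfinitesimal_normalizedSum [Fintype κ] {ρ : Matrix ι ι ℂ} (hρ : IsDensity ρ)
    {Z : κ → Matrix ι ι ℂ} (hZ : ∀ i, (Z i).IsHermitian) (hZ0 : ∀ i, (ρ * Z i).trace = 0)
    {P : ℕ → Matrix ι ι ℂ} {K : Matrix ι ι ℂ} (hP : Tendsto P atTop (𝓝 K))
    (hPh : ∀ᶠ n in atTop, (P n).IsHermitian)
    (hPtr : Tendsto (fun n : ℕ => Real.sqrt n • (ρ * P n).trace) atTop (𝓝 0)) (hK : ρ * K = 0) :
    IsInfinitesimal (fun n i => normalizedSum n (Z i)) (fun n => tensorPow n ρ) (covMatrix ρ Z Z)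
      (fun n => normalizedSum n (P n)) := by
  have hK' := mul_eq_zero_symm_of_isHermitian hρ.posSemidef.isHermitian
    (isHermitian_of_tendsto hP hPh) hK
  have htr : ∀ᶠ _ : ℕ in atTop, ρ.trace = 1 := .of_forall fun _ => hρ.trace_eq_one
  refine ⟨convergesInLaw_normalizedSum hρ.posSemidef tendsto_const_nhds htr hZ fun i => by
    simp [hZ0 i], hPh.mono fun _ hn => isHermitian_normalizedSum hn, fun s ξ η => ?_⟩
  have hlim := tendsto_trace_tensorPow_mul_prod_exp (ρ := fun _ => ρ) tendsto_const_nhds htr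
    (Y := fun t n => ∑ i, ξ t i • Z i + η t • P n) (c := fun t => η t * 0)
    (fun t => tendsto_const_nhds.add (hP.const_smul (η t))) fun t => by
      refine (hPtr.const_mul (η t)).congr fun _ => ?_
      simp [mul_add, Finset.mul_sum, Matrix.trace_sum, hZ0]
      ring
  simp only [trace_mul_add_mul_add hK hK'] at hlim
  convert hlim using 3
  · simp only [← coe_normalizedSumLinear, map_add, map_sum, map_smul]
  · simp [gaussianQuasiChar_covMatrix]

theorem tendsto_sqrt_smul_trace_mul_sqrt_smul {ρ A : Matrix ι ι ℂ} (hρ : ρ.trace = 1)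
    {ℓ : ℕ → Matrix ι ι ℂ} (hℓ : Tendsto (fun n : ℕ => Real.sqrt n • ℓ n) atTop (𝓝 A))
    (htr : Tendsto (fun n : ℕ => (n : ℝ) • ((ρ * NormedSpace.exp (ℓ n)).trace - 1)) atTop (𝓝 0)) :
    Tendsto (fun n : ℕ => Real.sqrt n • (ρ * Real.sqrt n • ℓ n).trace) atTop
      (𝓝 (-(1 / 2 * (ρ * A * A).trace))) := by
  have hexp : HasExpansion atTop (fun n : ℕ => (Real.sqrt n)⁻¹)
      (fun n => NormedSpace.exp ((Real.sqrt n)⁻¹ • Real.sqrt n • ℓ n)) (fun n => Real.sqrt n • ℓ n)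
      A ((1 / 2 : ℝ) • (A * A)) :=
    open scoped Matrix.Norms.Operator in HasExpansion.exp tendsto_inv_sqrt_natCast hℓ
  have hlim := htr.sub (hexp.tendsto_trace_mul tendsto_const_nhds (.of_forall fun _ => hρ))
  have hval : 0 - (ρ * (1 / 2 : ℝ) • (A * A)).trace = -(1 / 2 * (ρ * A * A).trace) := by
    rw [mul_smul_comm, Matrix.trace_smul, Complex.real_smul, Matrix.mul_assoc]
    norm_num
  rw [hval] at hlim
  refine hlim.congr' ?_
  filter_upwards [eventually_gt_atTop 0] with n hn
  rw [inv_smul_smul₀ (Real.sqrt_pos.2 (Nat.cast_pos.2 hn)).ne', inv_inv, inv_pow, inv_inv,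
    Real.sq_sqrt n.cast_nonneg, sub_sub_cancel]

theorem sum_embed_sub_eq_normalizedSum {n : ℕ} (hn : n ≠ 0) (ℓ S : Matrix ι ι ℂ) (q : ℂ) :
    ∑ k : Fin n, embed k ℓ - (normalizedSum n S - q • 1) =
      normalizedSum n (Real.sqrt n • ℓ - S + q • (Real.sqrt n)⁻¹ • 1) := by
  rw [sum_embed_eq_normalizedSum hn, one_eq_normalizedSum hn]
  simp only [← coe_normalizedSumLinear, map_sub, map_add, map_smul]
  abel

theorem isInfinitesimal_sum_embed_sub [Fintype κ] {ρ : Matrix ι ι ℂ} (hρ : IsDensity ρ)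
    {Z : κ → Matrix ι ι ℂ} (hZ : ∀ i, (Z i).IsHermitian) (hZ0 : ∀ i, (ρ * Z i).trace = 0)
    {ℓ : ℕ → Matrix ι ι ℂ} {A S : Matrix ι ι ℂ} (hℓh : ∀ᶠ n in atTop, (ℓ n).IsHermitian)
    (hℓ : Tendsto (fun n : ℕ => Real.sqrt n • ℓ n) atTop (𝓝 A))
    (htr : Tendsto (fun n : ℕ => (n : ℝ) • ((ρ * NormedSpace.exp (ℓ n)).trace - 1)) atTop (𝓝 0))
    (hS : S.IsHermitian) (hS0 : (ρ * S).trace = 0) (hAS : ρ * (A - S) = 0) :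
    IsInfinitesimal (fun n i => normalizedSum n (Z i)) (fun n => tensorPow n ρ) (covMatrix ρ Z Z)
      (fun n => ∑ k : Fin n, embed k (ℓ n) -
        (normalizedSum n S - (1 / 2 * (ρ * S * S).trace) • 1)) := by
  set q : ℂ := 1 / 2 * (ρ * S * S).trace with hq
  have hqh : star q = q := by
    rw [hq, star_mul', star_trace_mul_mul hρ.posSemidef.isHermitian hS hS]
    simp
  have hAh : A.IsHermitian := isHermitian_of_tendsto hℓ
    (hℓh.mono fun _ hn => hn.smul (IsSelfAdjoint.all _))
  have hAA : (ρ * A * A).trace = (ρ * S * S).trace := by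
    simpa using trace_mul_add_mul_add hAS
      (mul_eq_zero_symm_of_isHermitian hρ.posSemidef.isHermitian (hAh.sub hS) hAS) S S 1 1
  have hinv : Tendsto (fun n : ℕ => (Real.sqrt n)⁻¹) atTop (𝓝 0) :=
    tendsto_inv_sqrt_natCast.mono_right nhdsWithin_le_nhds
  have hP : Tendsto (fun n : ℕ => Real.sqrt n • ℓ n - S + q • (Real.sqrt n)⁻¹ • 1) atTop
      (𝓝 (A - S)) := by
    simpa using (hℓ.sub_const S).add ((hinv.smul_const (1 : Matrix ι ι ℂ)).const_smul q)
  have hPh : ∀ᶠ n : ℕ in atTop,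
      (Real.sqrt n • ℓ n - S + q • (Real.sqrt n)⁻¹ • 1).IsHermitian := by
    filter_upwards [hℓh] with n hn
    exact ((hn.smul (IsSelfAdjoint.all _)).sub hS).add
      ((Matrix.isHermitian_one.smul (IsSelfAdjoint.all _)).smul hqh)
  refine (isInfinitesimal_normalizedSum hρ hZ hZ0 hP hPh ?_ hAS).congr <|
    (eventually_ne_atTop 0).mono fun n hn => (sum_embed_sub_eq_normalizedSum hn _ S q).symm
  have hdrift := (tendsto_sqrt_smul_trace_mul_sqrt_smul hρ.trace_eq_one hℓ htr).add_const q
  rw [hAA, ← hq, neg_add_cancel] at hdrift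
  refine hdrift.congr' ?_
  filter_upwards [eventually_gt_atTop 0] with n hn
  have hsqrt : Real.sqrt n ≠ 0 := (Real.sqrt_pos.2 (Nat.cast_pos.2 hn)).ne'
  rw [mul_add, mul_sub, Matrix.trace_add, Matrix.trace_sub, hS0, sub_zero, smul_add,
    mul_smul_comm q, mul_smul_comm (Real.sqrt n)⁻¹, mul_one, Matrix.trace_smul, Matrix.trace_smul,
    hρ.trace_eq_one, smul_comm q, smul_inv_smul₀ hsqrt, smul_eq_mul, mul_one]

theorem isJointlyQLAN_tensorPow {d r : ℕ} {Θ : Set (Param d)} {ρ : Param d → Matrix ι ι ℂ}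
    (hρ : IsModel Θ ρ) {θ₀ : Param d} (hθ₀ : θ₀ ∈ Θ) (hac : ∀ θ ∈ Θ, AbsCont (ρ θ₀) (ρ θ))
    {B : Fin r → Matrix ι ι ℂ} (hB : ∀ i, (B i).IsHermitian) (hB0 : ∀ i, (ρ θ₀ * B i).trace = 0)
    {S : Fin d → Matrix ι ι ℂ} (hS : ∀ i, (S i).IsHermitian) (hS0 : ∀ i, (ρ θ₀ * S i).trace = 0)
    (hJ : ((covMatrix (ρ θ₀) S S).map Complex.re).PosDef) {L : Param d → Matrix ι ι ℂ}
    (hL : ∀ h, θ₀ + h ∈ Θ → IsLogLikelihoodRatio (L h) (ρ (θ₀ + h)) (ρ θ₀)) (hL0 : L 0 = 0)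
    {A : Param d →L[ℝ] Matrix ι ι ℂ} (hA : HasFDerivAt L A 0)
    (htr : (fun h => (ρ θ₀ * NormedSpace.exp (L h)).trace - 1) =o[𝓝 0]
      fun h : Param d => ‖h‖ ^ 2)
    (hAS : ∀ h, ρ θ₀ * (A h - ∑ i, (h i : ℂ) • S i) = 0) :
    IsJointlyQLAN Θ (fun n θ => tensorPow n (ρ θ)) θ₀ (fun n i => normalizedSum n (B i))
      (fun n i => normalizedSum n (S i)) (covMatrix (ρ θ₀) B B) (covMatrix (ρ θ₀) B S)
      (covMatrix (ρ θ₀) S S) := by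
  have hρ₀ := hρ.isDensity θ₀ hθ₀
  have hZ : ∀ i, (Sum.elim B S i).IsHermitian := by rintro (i | i) <;> simp [hB, hS]
  have hZ0 : ∀ i, (ρ θ₀ * Sum.elim B S i).trace = 0 := by rintro (i | i) <;> simp [hB0, hS0]
  have helim : ∀ n, Sum.elim (fun i => normalizedSum n (B i)) (fun i => normalizedSum n (S i)) =
      fun i => normalizedSum n (Sum.elim B S i) := fun n => by ext (i | i) <;> rfl
  refine
    { isModel := fun n _ => ⟨hρ.isOpen, fun θ hθ => isDensity_tensorPow (hρ.isDensity θ hθ)⟩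
      mem := hθ₀
      isHermitian_X := fun n _ i => isHermitian_normalizedSum (hB i)
      absCont := fun n _ θ hθ => absCont_tensorPow hρ₀.posSemidef.isHermitian
        (hρ.isDensity θ hθ).posSemidef (hac θ hθ)
      isHermitian_Δ := fun n _ i => isHermitian_normalizedSum (hS i)
      posSemidef_C := posSemidef_covMatrix hρ₀.posSemidef hB
      posSemidef_J := posSemidef_covMatrix hρ₀.posSemidef hS
      posDef_re_J := hJ
      convergesInLaw := ?_
      expansion := fun h => ⟨fun n => ∑ k : Fin n, embed k (L ((Real.sqrt n)⁻¹ • h)),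
        fun n _ hn => isLogLikelihoodRatio_tensorPow hρ₀.posSemidef (hL _ hn), ?_⟩ } <;>
    simp only [helim, fromBlocks_covMatrix hρ₀.posSemidef.isHermitian hB hS]
  · exact convergesInLaw_normalizedSum hρ₀.posSemidef tendsto_const_nhds
      (.of_forall fun _ => hρ₀.trace_eq_one) hZ fun i => by simp [hZ0 i]
  · have hmem := (tendsto_add_inv_sqrt_smul θ₀ h).eventually_mem (hρ.isOpen.mem_nhds hθ₀)
    have hslope : Tendsto (fun n : ℕ => Real.sqrt n • L ((Real.sqrt n)⁻¹ • h)) atTop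
        (𝓝 (A h)) := by
      open scoped Matrix.Norms.Operator in
      exact (tendsto_sqrt_smul_sub hA h).congr fun n => by rw [zero_add, hL0, sub_zero]
    simp only [sum_sum_covMatrix_mul_mul, sum_smul_normalizedSum]
    exact isInfinitesimal_sum_embed_sub hρ₀ hZ hZ0 (hmem.mono fun n hn => (hL _ hn).1) hslope
      (tendsto_natCast_smul_of_isLittleO htr h) (isHermitian_sum_ofReal_smul hS h)
      (by simp [Finset.mul_sum, Matrix.trace_sum, hS0]) (hAS h)

end LocalAsymptoticNormality

end QLAN

end

theorem mainTheorem4 {ι : Type*} [Fintype ι] [DecidableEq ι] {d r : ℕ}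
    (Θ : Set (QLAN.Param d)) (ρ : QLAN.Param d → Matrix ι ι ℂ) (hρ : QLAN.IsModel Θ ρ)
    (θ₀ : QLAN.Param d) (hθ₀ : θ₀ ∈ Θ)
    (hac : ∀ θ ∈ Θ, QLAN.AbsCont (ρ θ₀) (ρ θ))
    (B : Fin r → Matrix ι ι ℂ) (hB : ∀ i, (B i).IsHermitian)
    (hB0 : ∀ i, (ρ θ₀ * B i).trace = 0)
    (L : QLAN.Param d → Matrix ι ι ℂ)
    (hL : ∀ h, θ₀ + h ∈ Θ → QLAN.IsLogLikelihoodRatio (L h) (ρ (θ₀ + h)) (ρ θ₀))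
    (hL0 : L 0 = 0)
    (hdiff : DifferentiableAt ℝ L 0)
    (htr : (fun h => (ρ θ₀ * NormedSpace.exp (L h)).trace - 1) =o[𝓝 0]
      fun h : QLAN.Param d => ‖h‖ ^ 2) :
    (∃ S : Fin d → Matrix ι ι ℂ, ∀ i, QLAN.IsSLD ρ θ₀ i (S i)) ∧
    ∀ S : Fin d → Matrix ι ι ℂ, (∀ i, QLAN.IsSLD ρ θ₀ i (S i)) →
      (((QLAN.covMatrix (ρ θ₀) S S).map Complex.re).PosDef →
        QLAN.IsJointlyQLAN Θ (fun n θ => QLAN.tensorPow n (ρ θ)) θ₀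
          (fun n i => QLAN.normalizedSum n (B i))
          (fun n i => QLAN.normalizedSum n (S i))
          (QLAN.covMatrix (ρ θ₀) B B) (QLAN.covMatrix (ρ θ₀) B S)
          (QLAN.covMatrix (ρ θ₀) S S)) ∧
      ∀ h : QLAN.Param d,
        QLAN.ConvergesInLaw (fun n i => QLAN.normalizedSum n (B i))
          (fun n => QLAN.tensorPow n (ρ (θ₀ + (Real.sqrt n)⁻¹ • h)))
          (((QLAN.covMatrix (ρ θ₀) B S).map Complex.re).mulVec h)
          (QLAN.covMatrix (ρ θ₀) B B) := by
  have hA : ∀ h, (fderiv ℝ L 0 h).IsHermitian := fun h =>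
    open scoped Matrix.Norms.Frobenius in
    QLAN.isSelfAdjoint_fderiv_apply hdiff.hasFDerivAt
      ((hρ.eventually_mem hθ₀).mono fun h hh => (hL h hh).1) h
  have hρ' : HasFDerivAt ρ ((QLAN.jordanMul (ρ θ₀)).comp (fderiv ℝ L 0)) θ₀ :=
    hρ.hasFDerivAt hθ₀ hL hL0 hdiff.hasFDerivAt
      (htr.trans (Asymptotics.isLittleO_norm_pow_id one_lt_two))
  refine ⟨⟨fun i => fderiv ℝ L 0 (EuclideanSpace.single i 1), fun i =>
    QLAN.isSLD_of_hasFDerivAt hρ' (hA _) rfl⟩, fun S hS => ⟨fun hJ => ?_, fun h =>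
      QLAN.convergesInLaw_tensorPow_of_isSLD hρ hθ₀ hρ' hS hB hB0 h⟩⟩
  have hS0 : ∀ i, (ρ θ₀ * S i).trace = 0 := fun i => (hS i).trace_mul_eq_zero
    ((hρ.isOpen.eventually_mem hθ₀).mono fun θ hθ => (hρ.isDensity θ hθ).trace_eq_one)
  exact QLAN.isJointlyQLAN_tensorPow hρ hθ₀ hac hB hB0 (fun i => (hS i).1) hS0 hJ hL hL0
    hdiff.hasFDerivAt htr
    (QLAN.mul_sub_sum_smul_eq_zero_of_isSLD (hρ.isDensity θ₀ hθ₀).posSemidef hA hρ' hS)
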